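/- Let $\mathbb D$ be the open unit disc and $dA=\frac{dx\,dy}{\pi}$ the normalized area measure on $\mathbb D$. A radial weight is a nonnegative function $\omega\in L^1([0,1))$ with $\widehat\omega(r)=\int_r^1\omega(s)\,ds>0$ for all $0\le r<1$; it is extended to $\mathbb D$ by $\omega(z)=\omega(|z|)$, and likewise $\widehat\omega(z)=\widehat\omega(|z|)$. A radial weight $\omega$ belongs to $\widehat{\mathcal D}$ if there is $C>0$ such that $\widehat\omega(r)\le C\,\widehat\omega\left(\frac{1+r}{2}\right)$ for all $r<1$ sufficiently close to $1$, and to $\widecheck{\mathcal D}$ if there are $K>1$ and $C>1$ such that $\widehat\omega(r)\ge C\,\widehat\omega\left(1-\frac{1-r}{K}\right)$ for all $r<1$ sufficiently close to $1$. For a radial weight $\omega$ let $B^\omega_z(\zeta)=\sum_{n=0}^\infty\frac{(\overline z\zeta)^n}{2\omega_{2n+1}}$, $\omega_x=\int_0^1 s^x\omega(s)\,ds$, be the reproducing kernels of the weighted Bergman space $A^2_\omega$ of analytic functions $f$ in $\mathbb D$ with $\int_{\mathbb D}|f|^2\omega\,dA<\infty$, and let $$P_\omega f(z)=\int_{\mathbb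 D}f(\zeta)\,\overline{B^\omega_z(\zeta)}\,\omega(\zeta)\,dA(\zeta),\qquad z\in\mathbb D,$$ be the Bergman projection. For a radial weight $\nu$ let $L^\infty_{\widehat\nu}$ be the space of measurable $f:\mathbb D\to\mathbb C$ with $\|f\|_{\infty,\widehat\nu}=\operatorname{ess\,sup}_{z\in\mathbb D}|f(z)|\,\widehat\nu(z)<\infty$, let $H^\infty_{\widehat\nu}$ be the subspace of analytic functions in $L^\infty_{\widehat\nu}$, and let $\mathcal B^\infty_{\widehat\nu}$ be the space of analytic functions $f$ in $\mathbb D$ with $\|f\|_{\mathcal B^\infty_{\widehat\nu}}=\sup_{z\in\mathbb D}(1-|z|)\,\widehat\nu(z)\,|f'(z)|<\infty$. For $X=H^\infty_{\widehat\nu}$ or $X=\mathcal B^\infty_{\widehat\nu}$, $P_\omega$ is called bounded from $L^\infty_{\widehat\nu}$ to $X$ if there is a constant $C$ such that for every $f\in L^\infty_{\widehat\nu}$ the integral defining $P_\omega f(z)$ converges absolutely for every $z\in\mathbb D$, $P_\omega f\in X$, and $\|P_\omega f\|_X\le C\|f\|_{\infty,\widehat\nu}$. Let $\nu\in\widehat{\mathcal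 D}\setminus\widecheck{\mathcal D}$. Then, for every radial weight $\omega$, $P_\omega$ is not bounded from $L^\infty_{\widehat\nu}$ to $H^\infty_{\widehat\nu}$. However, there is a radial weight $\omega_\nu$ such that $P_{\omega_\nu}$ is bounded from $L^\infty_{\widehat\nu}$ to $\mathcal B^\infty_{\widehat\nu}$; in fact, one can take $\omega_\nu=\nu\widehat\nu$, which is a radial weight. -/

import Mathlib

open MeasureTheory Set Filter Topology
open scoped ENNReal NNReal ComplexConjugate

noncomputable section

namespace RadialBergman

/-- The open unit disc of the complex plane. -/
def disc : Set ℂ := Metric.ball 0 1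

/-- The normalized area measure `dA = dx dy / π` of the unit disc. -/
def areaMeasure : Measure ℂ := ENNReal.ofReal (Real.pi)⁻¹ • volume.restrict disc

/-- The tail integral `ω̂(r) = ∫_r^1 ω(s) ds`. -/
def tail (ω : ℝ → ℝ) (r : ℝ) : ℝ := ∫ s in r..1, ω s

/-- `ω` restricted to `[0,1)` is a radial weight: nonnegative, integrable, with positive tails.
Only the values on `[0,1)` matter. Its extension to the disc is `z ↦ ω ‖z‖`. -/
structure IsRadialWeight (ω : ℝ → ℝ) : Prop where
  nonneg : ∀ r ∈ Ico (0 : ℝ) 1, 0 ≤ ω r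
  integrableOn : IntegrableOn ω (Ico (0 : ℝ) 1)
  tail_pos : ∀ r ∈ Ico (0 : ℝ) 1, 0 < tail ω r

/-- The class of upper doubling radial weights. -/
def UpperDoubling (ω : ℝ → ℝ) : Prop :=
  IsRadialWeight ω ∧
    ∃ C : ℝ, 0 < C ∧ ∀ᶠ r in 𝓝[<] (1 : ℝ), tail ω r ≤ C * tail ω ((1 + r) / 2)

/-- The class of lower doubling radial weights. -/
def LowerDoubling (ω : ℝ → ℝ) : Prop :=
  IsRadialWeight ω ∧
    ∃ K : ℝ, 1 < K ∧ ∃ C : ℝ, 1 < C ∧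
      ∀ᶠ r in 𝓝[<] (1 : ℝ), C * tail ω (1 - (1 - r) / K) ≤ tail ω r

/-- The moment `∫_0^1 s^n ω(s) ds`. -/
def moment (ω : ℝ → ℝ) (n : ℕ) : ℝ := ∫ s in (0 : ℝ)..1, s ^ n * ω s

/-- Membership in the weighted Bergman space `A²_ω`. -/
def MemBergmanTwo (ω : ℝ → ℝ) (f : ℂ → ℂ) : Prop :=
  DifferentiableOn ℂ f disc ∧ Integrable (fun ζ => ‖f ζ‖ ^ 2 * ω ‖ζ‖) areaMeasure

/-- The reproducing kernel `B_z(ζ)` of `A²_ω`, as the series over the normalized monomials;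
`memBergmanTwo_bergmanKernel` and `bergmanKernel_reproducing` below prove that it is
the reproducing kernel. -/
def bergmanKernel (ω : ℝ → ℝ) (z ζ : ℂ) : ℂ :=
  ∑' n : ℕ, (conj z * ζ) ^ n / (2 * (moment ω (2 * n + 1) : ℂ))

/-- The integrand of the Bergman projection of `f` at the point `z`. -/
def bergmanIntegrand (ω : ℝ → ℝ) (f : ℂ → ℂ) (z ζ : ℂ) : ℂ :=
  f ζ * conj (bergmanKernel ω z ζ) * (ω ‖ζ‖ : ℂ)

/-- The Bergman projection `P_ω f (z) = ∫ f(ζ) conj(B_z(ζ)) ω(ζ) dA(ζ)`. -/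
def bergmanProjection (ω : ℝ → ℝ) (f : ℂ → ℂ) (z : ℂ) : ℂ :=
  ∫ ζ, bergmanIntegrand ω f z ζ ∂areaMeasure

/-- The norm `ess sup_{z ∈ 𝔻} |f(z)| v(z)`, with values in `[0, ∞]`. -/
def growthNorm (v : ℝ → ℝ) (f : ℂ → ℂ) : ℝ≥0∞ :=
  essSup (fun z => ENNReal.ofReal (‖f z‖ * v ‖z‖)) areaMeasure

/-- The growth space `L^∞_v`. -/
def MemGrowth (v : ℝ → ℝ) (f : ℂ → ℂ) : Prop :=
  AEStronglyMeasurable f areaMeasure ∧ growthNorm v f < ∞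

/-- The space `H^∞_v` of analytic functions in `L^∞_v`. -/
def MemHardyGrowth (v : ℝ → ℝ) (f : ℂ → ℂ) : Prop :=
  DifferentiableOn ℂ f disc ∧ MemGrowth v f

/-- The quantity `sup_{z ∈ 𝔻} (1 - |z|) v(z) |f'(z)|`, with values in `[0, ∞]`. -/
def blochNorm (v : ℝ → ℝ) (f : ℂ → ℂ) : ℝ≥0∞ :=
  ⨆ z ∈ disc, ENNReal.ofReal ((1 - ‖z‖) * v ‖z‖ * ‖deriv f z‖)

/-- The Bloch type space `B^∞_v`. -/
def MemBloch (v : ℝ → ℝ) (f : ℂ → ℂ) : Prop :=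
  DifferentiableOn ℂ f disc ∧ blochNorm v f < ∞

/-- `P_ω` is (well defined and) bounded from `L^∞_v` to `H^∞_v`. -/
def BoundedToHardyGrowth (ω v : ℝ → ℝ) : Prop :=
  ∃ C : ℝ≥0, ∀ f : ℂ → ℂ, MemGrowth v f →
    (∀ z ∈ disc, Integrable (bergmanIntegrand ω f z) areaMeasure) ∧
    MemHardyGrowth v (bergmanProjection ω f) ∧
    growthNorm v (bergmanProjection ω f) ≤ C * growthNorm v f

/-- `P_ω` is (well defined and) bounded from `L^∞_v` to `B^∞_v`. -/
def BoundedToBloch (ω v : ℝ → ℝ) : Prop :=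
  ∃ C : ℝ≥0, ∀ f : ℂ → ℂ, MemGrowth v f →
    (∀ z ∈ disc, Integrable (bergmanIntegrand ω f z) areaMeasure) ∧
    MemBloch v (bergmanProjection ω f) ∧
    blochNorm v (bergmanProjection ω f) ≤ C * growthNorm v f

/-! Consistency of the kernel with the abstract definition. -/

theorem integrableOn_pow_mul {ω : ℝ → ℝ} (h : IsRadialWeight ω) (n : ℕ) :
    IntegrableOn (fun s => s ^ n * ω s) (Ioo (0 : ℝ) 1) := by
  have h1 : IntegrableOn ω (Ioo (0 : ℝ) 1) := h.integrableOn.mono_set Ioo_subset_Ico_self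
  refine Integrable.mono h1 (by
    exact (continuous_pow n).aestronglyMeasurable.mul h1.aestronglyMeasurable) ?_
  refine (ae_restrict_mem measurableSet_Ioo).mono fun s hs => ?_
  rw [norm_mul]
  refine mul_le_of_le_one_left (norm_nonneg _) ?_
  rw [norm_pow, Real.norm_of_nonneg hs.1.le]
  exact pow_le_one₀ hs.1.le hs.2.le

theorem moment_eq (ω : ℝ → ℝ) (n : ℕ) :
    moment ω n = ∫ s in Ioo (0 : ℝ) 1, s ^ n * ω s := by
  rw [moment, intervalIntegral.integral_of_le zero_le_one, integral_Ioc_eq_integral_Ioo]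

theorem pow_mul_tail_le_moment {ω : ℝ → ℝ} (h : IsRadialWeight ω) (n : ℕ) {r : ℝ}
    (hr : r ∈ Ico (0 : ℝ) 1) : r ^ n * tail ω r ≤ moment ω n := by
  have h1 : IntegrableOn ω (Ioo (0 : ℝ) 1) := h.integrableOn.mono_set Ioo_subset_Ico_self
  have hsub : Ioo r 1 ⊆ Ioo (0 : ℝ) 1 := Ioo_subset_Ioo_left hr.1
  rw [moment_eq, tail, intervalIntegral.integral_of_le hr.2.le, integral_Ioc_eq_integral_Ioo,
    ← integral_const_mul]
  calc ∫ s in Ioo r 1, r ^ n * ω s ≤ ∫ s in Ioo r 1, s ^ n * ω s := by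
        refine setIntegral_mono_on ((h1.mono_set hsub).const_mul _)
          ((integrableOn_pow_mul h n).mono_set hsub) measurableSet_Ioo fun s hs => ?_
        exact mul_le_mul_of_nonneg_right (pow_le_pow_left₀ hr.1 hs.1.le n)
          (h.nonneg s ⟨hr.1.trans hs.1.le, hs.2⟩)
    _ ≤ ∫ s in Ioo (0 : ℝ) 1, s ^ n * ω s := by
        refine setIntegral_mono_set (integrableOn_pow_mul h n) ?_ hsub.eventuallyLE
        refine (ae_restrict_mem measurableSet_Ioo).mono fun s hs => ?_
        exact mul_nonneg (pow_nonneg hs.1.le n) (h.nonneg s ⟨hs.1.le, hs.2⟩)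

theorem moment_pos {ω : ℝ → ℝ} (h : IsRadialWeight ω) (n : ℕ) : 0 < moment ω n := by
  have hr : (1 / 2 : ℝ) ∈ Ico (0 : ℝ) 1 := by norm_num
  exact (mul_pos (by positivity) (h.tail_pos _ hr)).trans_le (pow_mul_tail_le_moment h n hr)

theorem summable_pow_div_moment {ω : ℝ → ℝ} (h : IsRadialWeight ω) {q : ℝ} (hq0 : 0 ≤ q)
    (hq : q < 1) : Summable fun n : ℕ => q ^ n / (2 * moment ω (2 * n + 1)) := by
  set r := Real.sqrt ((1 + q) / 2) with hrdef
  have hr2 : r ^ 2 = (1 + q) / 2 := Real.sq_sqrt (by linarith)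
  have hr0 : 0 < r := Real.sqrt_pos.2 (by linarith)
  have hr1 : r < 1 := by nlinarith
  have ht := h.tail_pos r ⟨hr0.le, hr1⟩
  have hg : Summable fun n : ℕ => (q / r ^ 2) ^ n * (2 * (r * tail ω r))⁻¹ := by
    refine (summable_geometric_of_lt_one (by positivity) ?_).mul_right _
    rw [div_lt_one (by positivity), hr2]
    linarith
  refine Summable.of_nonneg_of_le (fun n => ?_) (fun n => ?_) hg
  · have := moment_pos h (2 * n + 1)
    positivity
  · have h2 := pow_mul_tail_le_moment h (2 * n + 1) ⟨hr0.le, hr1⟩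
    have h3 : (q / r ^ 2) ^ n * (2 * (r * tail ω r))⁻¹
        = q ^ n / (2 * (r ^ (2 * n + 1) * tail ω r)) := by
      rw [div_pow, ← pow_mul, pow_succ]
      field_simp
    rw [h3]
    gcongr

theorem integrable_weight {ω : ℝ → ℝ} (h : IsRadialWeight ω) :
    Integrable (fun ζ : ℂ => ω ‖ζ‖) areaMeasure := by
  refine Integrable.smul_measure ?_ ENNReal.ofReal_ne_top
  have := (integrableOn_fun_norm_addHaar (volume : Measure ℂ) (f := ω) (r := 1)).2 (by
    simpa [Complex.finrank_real_complex] using integrableOn_pow_mul h 1)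
  exact this

theorem ae_mem_disc : ∀ᵐ ζ ∂areaMeasure, ζ ∈ disc :=
  Measure.ae_smul_measure (ae_restrict_mem Metric.isOpen_ball.measurableSet) _

theorem norm_lt_one {ζ : ℂ} (hζ : ζ ∈ disc) : ‖ζ‖ < 1 := by simpa [disc] using hζ

theorem norm_term {ω : ℝ → ℝ} (h : IsRadialWeight ω) {z ζ : ℂ} (n : ℕ) :
    ‖(conj z * ζ) ^ n / (2 * (moment ω (2 * n + 1) : ℂ))‖
      = (‖z‖ * ‖ζ‖) ^ n / (2 * moment ω (2 * n + 1)) := by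
  have := moment_pos h (2 * n + 1)
  simp [abs_of_pos this]

theorem norm_term_le {ω : ℝ → ℝ} (h : IsRadialWeight ω) {z ζ : ℂ} (hζ : ζ ∈ disc) (n : ℕ) :
    ‖(conj z * ζ) ^ n / (2 * (moment ω (2 * n + 1) : ℂ))‖
      ≤ ‖z‖ ^ n / (2 * moment ω (2 * n + 1)) := by
  have := moment_pos h (2 * n + 1)
  rw [norm_term h]
  gcongr
  exact mul_le_of_le_one_right (norm_nonneg _) (norm_lt_one hζ).le

theorem differentiableOn_bergmanKernel {ω : ℝ → ℝ} (h : IsRadialWeight ω) {z : ℂ}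
    (hz : z ∈ disc) : DifferentiableOn ℂ (bergmanKernel ω z) disc := by
  refine Complex.differentiableOn_tsum_of_summable_norm
    (summable_pow_div_moment h (norm_nonneg z) (norm_lt_one hz)) (fun n => ?_)
    Metric.isOpen_ball (fun n ζ hζ => norm_term_le h hζ n)
  fun_prop

theorem norm_bergmanKernel_le {ω : ℝ → ℝ} (h : IsRadialWeight ω) {z ζ : ℂ}
    (hz : z ∈ disc) (hζ : ζ ∈ disc) :
    ‖bergmanKernel ω z ζ‖ ≤ ∑' n : ℕ, ‖z‖ ^ n / (2 * moment ω (2 * n + 1)) :=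
  tsum_of_norm_bounded
    (summable_pow_div_moment h (norm_nonneg z) (norm_lt_one hz)).hasSum
    (fun n => norm_term_le h hζ n)

theorem aestronglyMeasurable_of_differentiableOn {f : ℂ → ℂ} (hf : DifferentiableOn ℂ f disc) :
    AEStronglyMeasurable f areaMeasure :=
  (hf.continuousOn.aestronglyMeasurable Metric.isOpen_ball.measurableSet).smul_measure _

/-- The kernel functions belong to `A²_ω`. -/
theorem memBergmanTwo_bergmanKernel {ω : ℝ → ℝ} (h : IsRadialWeight ω) {z : ℂ}
    (hz : z ∈ disc) : MemBergmanTwo ω (bergmanKernel ω z) := by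
  refine ⟨differentiableOn_bergmanKernel h hz, ?_⟩
  have hm := aestronglyMeasurable_of_differentiableOn (differentiableOn_bergmanKernel h hz)
  refine (integrable_weight h).bdd_mul (hm.norm.pow 2)
    (c := (∑' n : ℕ, ‖z‖ ^ n / (2 * moment ω (2 * n + 1))) ^ 2) ?_
  filter_upwards [ae_mem_disc] with ζ hζ
  rw [norm_pow, norm_norm]
  exact pow_le_pow_left₀ (norm_nonneg _) (norm_bergmanKernel_le h hz hζ) 2

theorem MemBergmanTwo.integrable {ω : ℝ → ℝ} (h : IsRadialWeight ω) {f : ℂ → ℂ}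
    (hf : MemBergmanTwo ω f) : Integrable (fun ζ => f ζ * (ω ‖ζ‖ : ℂ)) areaMeasure := by
  have hm := aestronglyMeasurable_of_differentiableOn hf.1
  refine ((integrable_weight h).add hf.2).mono
    (hm.mul (integrable_weight h).ofReal.aestronglyMeasurable) ?_
  filter_upwards [ae_mem_disc] with ζ hζ
  have h0 := h.nonneg ‖ζ‖ ⟨norm_nonneg ζ, norm_lt_one hζ⟩
  have : ‖f ζ‖ ≤ 1 + ‖f ζ‖ ^ 2 := by nlinarith [sq_nonneg (‖f ζ‖ - 1), norm_nonneg (f ζ)]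
  simp only [Pi.add_apply, norm_mul, Complex.norm_real, Real.norm_of_nonneg h0]
  rw [Real.norm_of_nonneg (by positivity)]
  nlinarith

theorem integrableOn_polar {F : ℂ → ℂ} (hF : Integrable F) :
    IntegrableOn (fun p : ℝ × ℝ => p.1 • F (Complex.polarCoord.symm p)) polarCoord.target := by
  have h1 : Integrable (fun p : ℝ × ℝ => F (Complex.measurableEquivRealProd.symm p)) :=
    (Complex.volume_preserving_equiv_real_prod.symm _).integrable_comp_of_integrable hF
  have h2 := (integrableOn_image_iff_integrableOn_abs_det_fderiv_smul volume
    polarCoord.open_target.measurableSet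
    (fun p _ => (hasFDerivAt_polarCoord_symm p).hasFDerivWithinAt) polarCoord.symm.injOn
    (fun p : ℝ × ℝ => F (Complex.measurableEquivRealProd.symm p))).1 h1.integrableOn
  refine h2.congr_fun (fun p hp => ?_) polarCoord.open_target.measurableSet
  have hp1 : 0 < p.1 := hp.1
  simp only [det_fderivPolarCoordSymm, abs_of_pos hp1]
  rfl

theorem polar_eq_circleMap (r θ : ℝ) :
    Complex.polarCoord.symm (r, θ) = circleMap 0 r θ := by
  simp [circleMap, Complex.exp_mul_I]

theorem integral_circle {f : ℂ → ℂ} (hf : DifferentiableOn ℂ f disc) (n : ℕ) {r : ℝ}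
    (hr0 : 0 < r) (hr1 : r < 1) :
    ∫ θ in Ioo (-Real.pi) Real.pi, f (circleMap 0 r θ) * conj (circleMap 0 r θ) ^ n
      = 2 * Real.pi * r ^ (2 * n) * (iteratedDeriv n f 0 / n.factorial) := by
  have hd : DifferentiableOn ℂ f (Metric.closedBall 0 r) :=
    hf.mono (Metric.closedBall_subset_ball hr1)
  have hc := hd.circleIntegral_one_div_sub_center_pow_smul hr0 n
  have hper : Function.Periodic
      (fun θ : ℝ => f (circleMap 0 r θ) * conj (circleMap 0 r θ) ^ n) (2 * Real.pi) := by
    intro θ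
    simp only [periodic_circleMap 0 r θ]
  have hswap := hper.intervalIntegral_add_eq (-Real.pi) 0
  rw [show -Real.pi + 2 * Real.pi = Real.pi by ring, zero_add] at hswap
  rw [← integral_Ioc_eq_integral_Ioo,
    ← intervalIntegral.integral_of_le (by linarith [Real.pi_pos]), hswap]
  have hcongr : ∀ θ : ℝ, f (circleMap 0 r θ) * conj (circleMap 0 r θ) ^ n
      = ((r : ℂ) ^ (2 * n) * Complex.I⁻¹) * (deriv (circleMap 0 r) θ •
        ((1 / (circleMap 0 r θ - 0) ^ (n + 1)) • f (circleMap 0 r θ))) := by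
    intro θ
    have hw : circleMap 0 r θ ≠ 0 := circleMap_ne_center hr0.ne'
    have hconj : conj (circleMap 0 r θ) = (r : ℂ) ^ 2 / circleMap 0 r θ := by
      rw [eq_div_iff hw, mul_comm, Complex.mul_conj, Complex.normSq_eq_norm_sq,
        norm_circleMap_zero, abs_of_pos hr0]
      push_cast
      rfl
    rw [hconj, deriv_circleMap, div_pow, ← pow_mul, smul_eq_mul, smul_eq_mul, sub_zero, pow_succ]
    field_simp [Complex.I_ne_zero]
  rw [intervalIntegral.integral_congr (fun θ _ => hcongr θ),
    intervalIntegral.integral_const_mul]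
  change _ * (∮ w in C(0, r), (1 / (w - 0) ^ (n + 1)) • f w) = _
  rw [hc, smul_eq_mul]
  field_simp [Complex.I_ne_zero]

theorem integral_mul_conj_pow {ω : ℝ → ℝ} (h : IsRadialWeight ω) {f : ℂ → ℂ}
    (hf : MemBergmanTwo ω f) (n : ℕ) :
    ∫ ζ, f ζ * conj ζ ^ n * (ω ‖ζ‖ : ℂ) ∂areaMeasure
      = 2 * (moment ω (2 * n + 1) : ℂ) * (iteratedDeriv n f 0 / n.factorial) := by
  have hpi := Real.pi_pos
  set a := iteratedDeriv n f 0 / (n.factorial : ℂ) with ha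
  have hInt : Integrable (fun ζ => f ζ * conj ζ ^ n * (ω ‖ζ‖ : ℂ)) areaMeasure := by
    have hb := (hf.integrable h).bdd_mul (f := fun ζ : ℂ => conj ζ ^ n) (c := 1)
      (by fun_prop) (by
        filter_upwards [ae_mem_disc] with ζ hζ
        simpa using pow_le_one₀ (norm_nonneg ζ) (norm_lt_one hζ).le)
    refine hb.congr (Eventually.of_forall fun ζ => ?_)
    simp only
    ring
  have hInt' : IntegrableOn (fun ζ => f ζ * conj ζ ^ n * (ω ‖ζ‖ : ℂ)) disc := by
    refine (integrable_smul_measure ?_ ENNReal.ofReal_ne_top).1 hInt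
    simpa using hpi
  have hms : MeasurableSet disc := Metric.isOpen_ball.measurableSet
  have hind := (integrable_indicator_iff hms).2 hInt'
  set G : ℂ → ℂ := disc.indicator (fun ζ => f ζ * conj ζ ^ n * (ω ‖ζ‖ : ℂ)) with hG
  have hpol := integrableOn_polar hind
  have key : ∫ ζ, G ζ = 2 * Real.pi * (moment ω (2 * n + 1) : ℂ) * a := by
    rw [← Complex.integral_comp_polarCoord_symm]
    rw [polarCoord_target, Measure.volume_eq_prod] at *
    rw [setIntegral_prod _ hpol]
    have hinner : ∀ r ∈ Ioi (0 : ℝ),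
        ∫ θ in Ioo (-Real.pi) Real.pi, r • G (Complex.polarCoord.symm (r, θ))
        = (Ioo (0 : ℝ) 1).indicator (fun r => 2 * Real.pi * a *
            ((r ^ (2 * n + 1) * ω r : ℝ) : ℂ)) r := by
      intro r hr
      have hr0 : 0 < r := hr
      by_cases hr1 : r < 1
      · rw [indicator_of_mem (show r ∈ Ioo (0 : ℝ) 1 from ⟨hr0, hr1⟩)]
        have : ∀ θ : ℝ, r • G (Complex.polarCoord.symm (r, θ))
            = ((r : ℂ) * (ω r : ℂ)) * (f (circleMap 0 r θ) * conj (circleMap 0 r θ) ^ n) := by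
          intro θ
          have hn : ‖circleMap 0 r θ‖ = r := by rw [norm_circleMap_zero, abs_of_pos hr0]
          rw [polar_eq_circleMap, hG, indicator_of_mem (by simpa [disc, abs_of_pos hr0] using hr1),
            hn, Complex.real_smul]
          ring
        simp only [this]
        rw [integral_const_mul, integral_circle hf.1 n hr0 hr1]
        push_cast
        ring
      · rw [indicator_of_notMem (by simp [hr1])]
        refine integral_eq_zero_of_ae (Eventually.of_forall fun θ => ?_)
        simp only [polar_eq_circleMap, hG, Pi.zero_apply]
        rw [indicator_of_notMem (by simpa [disc, abs_of_pos hr0] using hr1), smul_zero]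
    rw [setIntegral_congr_fun measurableSet_Ioi hinner, setIntegral_indicator measurableSet_Ioo,
      inter_eq_right.2 Ioo_subset_Ioi_self, integral_const_mul, integral_complex_ofReal,
      ← moment_eq]
    ring
  rw [areaMeasure, integral_smul_measure, ← integral_indicator hms, key,
    ENNReal.toReal_ofReal (by positivity), Complex.real_smul]
  have : (Real.pi : ℂ) ≠ 0 := by exact_mod_cast hpi.ne'
  push_cast
  field_simp

/-- The kernel functions reproduce the functions of `A²_ω`. -/
theorem bergmanKernel_reproducing {ω : ℝ → ℝ} (h : IsRadialWeight ω) {f : ℂ → ℂ}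
    (hf : MemBergmanTwo ω f) {z : ℂ} (hz : z ∈ disc) : bergmanProjection ω f z = f z := by
  set c : ℕ → ℂ := fun n => z ^ n / (2 * (moment ω (2 * n + 1) : ℂ)) with hc
  have hcn : ∀ n, ‖c n‖ = ‖z‖ ^ n / (2 * moment ω (2 * n + 1)) := fun n => by
    have := moment_pos h (2 * n + 1)
    simp [hc, abs_of_pos this]
  have hcs : Summable fun n => ‖c n‖ := by
    simpa only [hcn] using summable_pow_div_moment h (norm_nonneg z) (norm_lt_one hz)
  have hb : ∀ n : ℕ, Integrable (fun ζ : ℂ => conj ζ ^ n * (f ζ * (ω ‖ζ‖ : ℂ))) areaMeasure :=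
    fun n => (hf.integrable h).bdd_mul (f := fun ζ : ℂ => conj ζ ^ n) (c := 1)
      (by fun_prop) (by
        filter_upwards [ae_mem_disc] with ζ hζ
        simpa using pow_le_one₀ (norm_nonneg ζ) (norm_lt_one hζ).le)
  have hsum := hasSum_integral_of_summable_integral_norm (μ := areaMeasure)
    (F := fun (n : ℕ) (ζ : ℂ) => c n * (conj ζ ^ n * (f ζ * (ω ‖ζ‖ : ℂ))))
    (fun n => (hb n).const_mul _) (by
      refine Summable.of_nonneg_of_le (fun n => integral_nonneg fun ζ => norm_nonneg _)
        (fun n => ?_) (hcs.mul_right (∫ ζ, ‖f ζ * (ω ‖ζ‖ : ℂ)‖ ∂areaMeasure))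
      rw [← integral_const_mul]
      refine integral_mono_ae ((hb n).const_mul _).norm ((hf.integrable h).norm.const_mul _) ?_
      filter_upwards [ae_mem_disc] with ζ hζ
      simp only [norm_mul (c n), norm_mul (conj ζ ^ n)]
      refine mul_le_mul_of_nonneg_left ?_ (norm_nonneg _)
      refine mul_le_of_le_one_left (norm_nonneg _) ?_
      simpa using pow_le_one₀ (norm_nonneg ζ) (norm_lt_one hζ).le)
  have hL : ∀ n : ℕ, ∫ ζ, c n * (conj ζ ^ n * (f ζ * (ω ‖ζ‖ : ℂ))) ∂areaMeasure
      = (n.factorial : ℂ)⁻¹ • (z - 0) ^ n • iteratedDeriv n f 0 := by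
    intro n
    have hm : (moment ω (2 * n + 1) : ℂ) ≠ 0 := by
      exact_mod_cast (moment_pos h (2 * n + 1)).ne'
    have h1 : ∫ ζ, conj ζ ^ n * (f ζ * (ω ‖ζ‖ : ℂ)) ∂areaMeasure
        = ∫ ζ, f ζ * conj ζ ^ n * (ω ‖ζ‖ : ℂ) ∂areaMeasure :=
      integral_congr_ae (Eventually.of_forall fun ζ => by simp only; ring)
    rw [integral_const_mul, h1, integral_mul_conj_pow h hf, hc, smul_eq_mul, smul_eq_mul, sub_zero]
    field_simp
  simp only [hL] at hsum
  rw [← hsum.unique (Complex.hasSum_taylorSeries_on_ball hf.1 hz)]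
  refine integral_congr_ae (Eventually.of_forall fun ζ => ?_)
  simp only [bergmanIntegrand, bergmanKernel, Complex.conj_tsum]
  rw [mul_assoc, mul_comm, mul_assoc, ← tsum_mul_right]
  refine tsum_congr fun n => ?_
  simp only [hc, map_div₀, map_pow, map_mul, Complex.conj_conj, Complex.conj_ofReal, map_ofNat,
    mul_pow]
  ring

end RadialBergman

end

namespace RadialBergman

/-! ### Tails of radial weights -/

/-! Write `ν̂` for `tail ν` and `ω = ν ν̂`. Upper doubling enters through one estimate,
`UpperDoubling.exists_pow_mul_tail_pow_le`: `ν̂` changes at most polynomially in the ratio of the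
distances to 1, so a factor `s ^ n` with `n (1 - r) ≳ 1` absorbs the growth of any power of `ν̂ s /
ν̂ r` for `s < r`.

Positive part. If `|f| ν̂ ≤ N`, then `|f| ω ≤ N ν`, so it remains to integrate the differentiated
kernel against `ν`. Moments of `ω` of order about `1 / (1 - r)` are comparable to `ν̂ r ^ 2`. The
Taylor coefficients of the differentiated kernel are therefore of size `m / ν̂ ^ 2`, and their
consecutive differences of size `1 / ν̂ ^ 2`, at the point `1 - 1 / (m + 2)`. Taking differences
amounts to multiplying the series by `1 - q e^{iθ}`; Cauchy–Schwarz with Parseval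
(`integral_norm_unimod_series_le`) then bounds the `L¹` norm on a circle by a multiple of `1 /
(ν̂(|q|) ^ 2 (1 - |q|))`. The remaining radial integral, of `ν s / ν̂ (min s r) ^ 2`, is at most `5
/ ν̂ r` (`integral_div_tail_min_sq_le`), which is exactly the Bloch bound.

Negative part. The test function is `arg ζ / ν̂ |ζ|`. The Fourier coefficients of `arg` have size `1
/ n` with alternating signs, so at `z = -ρ` all terms of the projection have the same phase and any
finite set of them bounds it from below (`sum_le_norm_bergmanProjection_arg`). For every weight `ω`,
upper doubling of `ν` makes each term with `1 / (1 - r) ≤ n ≤ 1 / (1 - ρ)` at least a constant times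
`1 / (n ν̂ r)` (`UpperDoubling.exists_moment_le_mul_integral`). Summing gives `log K / ν̂ r` with `1
- ρ = (1 - r) / K`. Without lower doubling there are, for every `K`, points `r` with `ν̂ r < 2 ν̂
ρ`, so `ν̂ ρ` times the projection at `-ρ` is at least of order `log K`, which is unbounded. -/

theorem IsRadialWeight.intervalIntegrable {ω : ℝ → ℝ} (h : IsRadialWeight ω) {a b : ℝ}
    (ha : a ∈ Icc (0 : ℝ) 1) (hb : b ∈ Icc (0 : ℝ) 1) : IntervalIntegrable ω volume a b := by
  have h1 : IntervalIntegrable ω volume 0 1 := by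
    rw [intervalIntegrable_iff_integrableOn_Ico_of_le zero_le_one]
    exact h.integrableOn
  refine h1.mono_set ?_
  rw [uIcc_of_le zero_le_one]
  exact uIcc_subset_Icc ha hb

theorem tail_sub {ω : ℝ → ℝ} (h : IsRadialWeight ω) {a b : ℝ}
    (ha : a ∈ Icc (0 : ℝ) 1) (hb : b ∈ Icc (0 : ℝ) 1) :
    tail ω a - tail ω b = ∫ s in a..b, ω s := by
  have h1 : (1 : ℝ) ∈ Icc (0 : ℝ) 1 := by simp
  have := intervalIntegral.integral_add_adjacent_intervals
    (h.intervalIntegrable ha hb) (h.intervalIntegrable hb h1)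
  simp only [tail]
  linarith

theorem tail_one (ω : ℝ → ℝ) : tail ω 1 = 0 := by simp [tail]

theorem integral_nonneg_of_weight {ω : ℝ → ℝ} (h : IsRadialWeight ω) {a b : ℝ}
    (ha : 0 ≤ a) (hab : a ≤ b) (hb : b ≤ 1) : 0 ≤ ∫ s in a..b, ω s := by
  rw [intervalIntegral.integral_of_le hab, integral_Ioc_eq_integral_Ioo]
  exact setIntegral_nonneg measurableSet_Ioo fun s hs =>
    h.nonneg s ⟨ha.trans hs.1.le, hs.2.trans_le hb⟩

theorem tail_antitoneOn {ω : ℝ → ℝ} (h : IsRadialWeight ω) :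
    AntitoneOn (tail ω) (Icc (0 : ℝ) 1) := by
  intro a ha b hb hab
  have h1 := tail_sub h ha hb
  have h2 := integral_nonneg_of_weight h ha.1 hab hb.2
  linarith

theorem tail_le_tail {ω : ℝ → ℝ} (h : IsRadialWeight ω) {a b : ℝ}
    (ha : 0 ≤ a) (hab : a ≤ b) (hb : b ≤ 1) : tail ω b ≤ tail ω a :=
  tail_antitoneOn h ⟨ha, hab.trans hb⟩ ⟨ha.trans hab, hb⟩ hab

theorem tail_continuousOn {ω : ℝ → ℝ} (h : IsRadialWeight ω) :
    ContinuousOn (tail ω) (Icc (0 : ℝ) 1) := by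
  have := intervalIntegral.continuousOn_primitive_interval_left (μ := volume) (f := ω)
    (a := 0) (b := 1) (by
      rw [uIcc_of_le zero_le_one, integrableOn_Icc_iff_integrableOn_Ico]
      exact h.integrableOn)
  rwa [uIcc_of_le zero_le_one] at this

theorem exists_tail_eq {ω : ℝ → ℝ} (h : IsRadialWeight ω) {a b y : ℝ} (ha : 0 ≤ a)
    (hab : a ≤ b) (hb : b ≤ 1) (hy : y ∈ Icc (tail ω b) (tail ω a)) :
    ∃ s ∈ Icc a b, tail ω s = y :=
  intermediate_value_Icc' hab ((tail_continuousOn h).mono (Icc_subset_Icc ha hb)) hy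

theorem UpperDoubling.exists_forall_tail_le {ν : ℝ → ℝ} (h : UpperDoubling ν) :
    ∃ D : ℝ, 1 ≤ D ∧ ∀ r ∈ Ico (0 : ℝ) 1, tail ν r ≤ D * tail ν ((1 + r) / 2) := by
  obtain ⟨hw, C, hC, hev⟩ := h
  obtain ⟨l, hl, hlt⟩ := (mem_nhdsLT_iff_exists_Ioo_subset (a := (1 : ℝ))).1 hev
  -- Beyond `r₀` the eventual bound applies since `(l + 1) / 2 > l`; before it, monotonicity alone
  -- bounds the ratio.
  set r₀ := max 0 ((l + 1) / 2)
  have hl1 : l < 1 := hl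
  have hr0 : r₀ ∈ Ico (0 : ℝ) 1 := ⟨le_max_left _ _, max_lt one_pos (by linarith)⟩
  have hr1 : (1 + r₀) / 2 ∈ Ico (0 : ℝ) 1 := ⟨by linarith [hr0.1], by linarith [hr0.2]⟩
  have hp := hw.tail_pos _ hr1
  refine ⟨max 1 (max C (tail ν 0 / tail ν ((1 + r₀) / 2))), le_max_left _ _, fun r hr => ?_⟩
  have hm : (1 + r) / 2 ∈ Ico (0 : ℝ) 1 := ⟨by linarith [hr.1], by linarith [hr.2]⟩
  have hpm := hw.tail_pos _ hm
  rcases le_total r₀ r with hrr | hrr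
  · have h1 : tail ν r ≤ C * tail ν ((1 + r) / 2) :=
      hlt ⟨by linarith [le_max_right 0 ((l + 1) / 2)], hr.2⟩
    exact h1.trans (mul_le_mul_of_nonneg_right
      ((le_max_left _ _).trans (le_max_right _ _)) hpm.le)
  · calc tail ν r ≤ tail ν 0 := tail_le_tail hw le_rfl hr.1 hr.2.le
      _ = tail ν 0 / tail ν ((1 + r₀) / 2) * tail ν ((1 + r₀) / 2) := by field_simp
      _ ≤ _ := by
        refine mul_le_mul ((le_max_right _ _).trans (le_max_right _ _))
          (tail_le_tail hw hm.1 (by linarith) hr1.2.le) hp.le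
          (zero_le_one.trans (le_max_left _ _))

/-- Tails of upper doubling weights decrease at most polynomially. -/
theorem UpperDoubling.exists_tail_le_pow {ν : ℝ → ℝ} (h : UpperDoubling ν) :
    ∃ A : ℝ, 1 ≤ A ∧ ∃ β : ℕ, ∀ s ∈ Ico (0 : ℝ) 1, ∀ r ∈ Ico (0 : ℝ) 1, ∀ t : ℝ, 1 ≤ t →
      1 - s ≤ t * (1 - r) → tail ν s ≤ A * t ^ β * tail ν r := by
  obtain ⟨D, hD, hdb⟩ := h.exists_forall_tail_le
  have key : ∀ k : ℕ, ∀ s ∈ Ico (0 : ℝ) 1, ∀ r ∈ Ico (0 : ℝ) 1,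
      1 - s ≤ 2 ^ k * (1 - r) → tail ν s ≤ D ^ k * tail ν r := by
    intro k
    induction k with
    | zero =>
      intro s hs r hr hsr
      simpa using tail_le_tail h.1 hr.1 (by linarith) hs.2.le
    | succ k ih =>
      intro s hs r hr hsr
      have hm : (1 + s) / 2 ∈ Ico (0 : ℝ) 1 := ⟨by linarith [hs.1], by linarith [hs.2]⟩
      have h1 := ih _ hm r hr (by rw [pow_succ] at hsr; linarith)
      calc tail ν s ≤ D * tail ν ((1 + s) / 2) := hdb s hs
        _ ≤ D * (D ^ k * tail ν r) := by gcongr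
        _ = _ := by ring
  -- Since `D < 2 ^ β`, the iterated doubling constant is a power of the distance ratio.
  obtain ⟨β, hβ⟩ := pow_unbounded_of_one_lt D (one_lt_two (α := ℝ))
  refine ⟨2 ^ β, one_le_pow₀ one_le_two, β, fun s hs r hr t ht hst => ?_⟩
  obtain ⟨n, hn1, hn2⟩ := exists_nat_pow_near ht (one_lt_two (α := ℝ))
  have hr' : 0 ≤ 1 - r := by linarith [hr.2]
  refine (key (n + 1) s hs r hr (hst.trans (by gcongr))).trans ?_
  refine mul_le_mul_of_nonneg_right ?_ (h.1.tail_pos r hr).le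
  calc D ^ (n + 1) ≤ (2 ^ β) ^ (n + 1) := by gcongr
    _ = (2 * 2 ^ n) ^ β := by rw [← pow_mul, ← pow_succ', ← pow_mul, mul_comm]
    _ ≤ (2 * t) ^ β := by gcongr
    _ = _ := by rw [mul_pow]

/-- Combines `s ^ n ≤ e^{-n(1-s)} ≤ e^{-t}` with `t ^ j / j! ≤ e^t`. -/
theorem pow_mul_pow_le_factorial {s t : ℝ} {n j : ℕ} (hs : 0 ≤ s) (ht : 0 ≤ t)
    (hst : t ≤ n * (1 - s)) : s ^ n * t ^ j ≤ j.factorial := by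
  have h1 : s ≤ Real.exp (-(1 - s)) := by
    have := Real.add_one_le_exp (-(1 - s))
    linarith
  have h2 : s ^ n ≤ Real.exp (-t) :=
    calc s ^ n ≤ Real.exp (-(1 - s)) ^ n := by gcongr
      _ = Real.exp (-(n * (1 - s))) := by rw [← Real.exp_nat_mul]; ring_nf
      _ ≤ _ := by gcongr
  have h3 := Real.pow_div_factorial_le_exp t ht j
  have hj : (0 : ℝ) < j.factorial := by positivity
  rw [div_le_iff₀ hj] at h3
  calc s ^ n * t ^ j ≤ Real.exp (-t) * (Real.exp t * j.factorial) := by gcongr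
    _ = j.factorial := by rw [← mul_assoc, ← Real.exp_add]; simp

/-- For `s ≥ r` this is monotonicity. For `s < r` put `t = (1 - s) / (1 - r)`: the tails have ratio
at most `A t ^ β`, while `t / 2 ≤ n (1 - s)`, so `s ^ n` decays like `e^{-t/2}` and beats the
polynomial. -/
theorem UpperDoubling.exists_pow_mul_tail_pow_le {ν : ℝ → ℝ} (h : UpperDoubling ν) (j : ℕ) :
    ∃ C : ℝ, 0 < C ∧ ∀ (n : ℕ), ∀ s ∈ Ico (0 : ℝ) 1, ∀ r ∈ Ico (0 : ℝ) 1,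
      1 ≤ 2 * n * (1 - r) → s ^ n * tail ν s ^ j ≤ C * tail ν r ^ j := by
  obtain ⟨A, hA, β, hb⟩ := h.exists_tail_le_pow
  refine ⟨A ^ j * 2 ^ (β * j) * (β * j).factorial, by positivity, fun n s hs r hr hn => ?_⟩
  have hvr := h.1.tail_pos r hr
  have hvs := h.1.tail_pos s hs
  have hr' : 0 < 1 - r := by linarith [hr.2]
  have hs' : 0 < 1 - s := by linarith [hs.2]
  have hn' : (0 : ℝ) ≤ n := n.cast_nonneg
  rcases le_total r s with hrs | hrs
  · have h1 := tail_le_tail h.1 hr.1 hrs hs.2.le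
    have h2 : s ^ n ≤ 1 := pow_le_one₀ hs.1 hs.2.le
    have h3 : 1 ≤ A ^ j * 2 ^ (β * j) * ((β * j).factorial : ℝ) := by
      have : (1 : ℝ) ≤ (β * j).factorial := by exact_mod_cast Nat.factorial_pos _
      have := one_le_pow₀ (n := j) hA
      have := one_le_pow₀ (n := β * j) (one_le_two (α := ℝ))
      refine one_le_mul_of_one_le_of_one_le (one_le_mul_of_one_le_of_one_le ?_ ?_) ?_ <;>
      assumption
    gcongr
    exact h2.trans h3
  · set t := (1 - s) / (1 - r)
    have ht : 1 ≤ t := by rw [one_le_div hr']; linarith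
    have h1 := hb s hs r hr t ht (div_mul_cancel₀ _ hr'.ne').ge
    have h2 : s ^ n * (t / 2) ^ (β * j) ≤ (β * j).factorial := by
      refine pow_mul_pow_le_factorial hs.1 (by positivity) ?_
      rw [div_div, div_le_iff₀ (by positivity)]
      nlinarith
    calc s ^ n * tail ν s ^ j ≤ s ^ n * (A * t ^ β * tail ν r) ^ j := by
          have := pow_nonneg hs.1 n
          gcongr
      _ = A ^ j * 2 ^ (β * j) * (s ^ n * (t / 2) ^ (β * j)) * tail ν r ^ j := by
          rw [mul_assoc (A ^ j), mul_left_comm (2 ^ (β * j)), ← mul_pow,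
            mul_div_cancel₀ t two_ne_zero, mul_pow, mul_pow, pow_mul]
          ring
      _ ≤ _ := by gcongr

/-! ### The Bergman projection as a power series -/

theorem integrable_conj_pow_mul {g : ℂ → ℂ} (hg : Integrable g areaMeasure) (n : ℕ) :
    Integrable (fun ζ : ℂ => conj ζ ^ n * g ζ) areaMeasure :=
  hg.bdd_mul (f := fun ζ : ℂ => conj ζ ^ n) (c := 1) (by fun_prop) (by
    filter_upwards [ae_mem_disc] with ζ hζ
    simpa using pow_le_one₀ (norm_nonneg ζ) (norm_lt_one hζ).le)

theorem norm_integral_conj_pow_mul_le {g : ℂ → ℂ} (hg : Integrable g areaMeasure) (n : ℕ) :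
    ∫ ζ : ℂ, ‖conj ζ ^ n * g ζ‖ ∂areaMeasure ≤ ∫ ζ, ‖g ζ‖ ∂areaMeasure := by
  refine integral_mono_ae (integrable_conj_pow_mul hg n).norm hg.norm ?_
  filter_upwards [ae_mem_disc] with ζ hζ
  rw [norm_mul]
  refine mul_le_of_le_one_left (norm_nonneg _) ?_
  simpa using pow_le_one₀ (norm_nonneg ζ) (norm_lt_one hζ).le

theorem hasSum_integral_conj_series {d : ℕ → ℂ} (hd : Summable fun n => ‖d n‖) {g : ℂ → ℂ}
    (hg : Integrable g areaMeasure) :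
    HasSum (fun n => d n * ∫ ζ : ℂ, conj ζ ^ n * g ζ ∂areaMeasure)
      (∫ ζ : ℂ, (∑' n, d n * conj ζ ^ n) * g ζ ∂areaMeasure) := by
  have hsum := hasSum_integral_of_summable_integral_norm (μ := areaMeasure)
    (F := fun (n : ℕ) (ζ : ℂ) => d n * (conj ζ ^ n * g ζ))
    (fun n => (integrable_conj_pow_mul hg n).const_mul _) (by
      refine Summable.of_nonneg_of_le (fun n => integral_nonneg fun ζ => norm_nonneg _)
        (fun n => ?_) (hd.mul_right (∫ ζ, ‖g ζ‖ ∂areaMeasure))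
      simp only [norm_mul (d n)]
      rw [integral_const_mul]
      exact mul_le_mul_of_nonneg_left (norm_integral_conj_pow_mul_le hg n) (norm_nonneg _))
  simp only [integral_const_mul] at hsum
  have he : ∫ ζ : ℂ, (∑' n, d n * conj ζ ^ n) * g ζ ∂areaMeasure
      = ∫ ζ : ℂ, ∑' n, d n * (conj ζ ^ n * g ζ) ∂areaMeasure :=
    integral_congr_ae (Eventually.of_forall fun ζ => by
      simp only [← tsum_mul_right, mul_assoc])
  rw [he]
  exact hsum

theorem bergmanIntegrand_eq (ω : ℝ → ℝ) (f : ℂ → ℂ) (z ζ : ℂ) :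
    bergmanIntegrand ω f z ζ =
      (∑' n : ℕ, z ^ n / (2 * (moment ω (2 * n + 1) : ℂ)) * conj ζ ^ n)
        * (f ζ * (ω ‖ζ‖ : ℂ)) := by
  simp only [bergmanIntegrand, bergmanKernel, Complex.conj_tsum]
  rw [mul_assoc, mul_comm, mul_assoc, mul_comm (ω ‖ζ‖ : ℂ)]
  congr 1
  refine tsum_congr fun n => ?_
  simp only [map_div₀, map_pow, map_mul, Complex.conj_conj, Complex.conj_ofReal, map_ofNat,
    mul_pow]
  ring

theorem integrable_bergmanIntegrand {ω : ℝ → ℝ} (h : IsRadialWeight ω) {f : ℂ → ℂ}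
    (hf : Integrable (fun ζ => f ζ * (ω ‖ζ‖ : ℂ)) areaMeasure) {z : ℂ} (hz : z ∈ disc) :
    Integrable (bergmanIntegrand ω f z) areaMeasure := by
  have hm := aestronglyMeasurable_of_differentiableOn (differentiableOn_bergmanKernel h hz)
  have := hf.bdd_mul (f := fun ζ => conj (bergmanKernel ω z ζ))
    (c := ∑' n : ℕ, ‖z‖ ^ n / (2 * moment ω (2 * n + 1)))
    (Complex.continuous_conj.comp_aestronglyMeasurable hm) (by
      filter_upwards [ae_mem_disc] with ζ hζ
      rw [RCLike.norm_conj]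
      exact norm_bergmanKernel_le h hz hζ)
  refine this.congr (Eventually.of_forall fun ζ => ?_)
  simp only [bergmanIntegrand]
  ring

theorem norm_pow_div_moment {ω : ℝ → ℝ} (h : IsRadialWeight ω) (z : ℂ) (n : ℕ) :
    ‖z ^ n / (2 * (moment ω (2 * n + 1) : ℂ))‖ = ‖z‖ ^ n / (2 * moment ω (2 * n + 1)) := by
  have := moment_pos h (2 * n + 1)
  simp [abs_of_pos this]

theorem hasSum_bergmanProjection {ω : ℝ → ℝ} (h : IsRadialWeight ω) {f : ℂ → ℂ}
    (hf : Integrable (fun ζ => f ζ * (ω ‖ζ‖ : ℂ)) areaMeasure) {z : ℂ} (hz : z ∈ disc) :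
    HasSum (fun n : ℕ => z ^ n / (2 * (moment ω (2 * n + 1) : ℂ)) *
      ∫ ζ : ℂ, conj ζ ^ n * (f ζ * (ω ‖ζ‖ : ℂ)) ∂areaMeasure) (bergmanProjection ω f z) := by
  have hs : Summable fun n : ℕ => ‖z ^ n / (2 * (moment ω (2 * n + 1) : ℂ))‖ := by
    simp only [norm_pow_div_moment h]
    exact summable_pow_div_moment h (norm_nonneg z) (norm_lt_one hz)
  rw [show bergmanProjection ω f z = _ from
    integral_congr_ae (Eventually.of_forall fun ζ => bergmanIntegrand_eq ω f z ζ)]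
  exact hasSum_integral_conj_series hs hf

theorem summable_succ_mul_pow_div_moment {ω : ℝ → ℝ} (h : IsRadialWeight ω) {x : ℝ} (hx0 : 0 ≤ x)
    (hx : x < 1) :
    Summable fun m : ℕ => (m + 1) * x ^ m / (2 * moment ω (2 * (m + 1) + 1)) := by
  set y := (1 + x) / 2 with hy
  have hy0 : 0 < y := by positivity
  have hxy : x < y := by linarith
  have hy1 : y < 1 := by linarith
  set R := (1 + y) / 2 with hR
  have hR0 : 0 < R := by positivity
  have hyR : y < R := by linarith
  have hR1 : R < 1 := by linarith
  have hs : 0 < 1 - y / R := by rw [sub_pos, div_lt_one hR0]; exact hyR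
  have hsum := (summable_nat_add_iff 1).2 (summable_pow_div_moment h hR0.le hR1)
  refine Summable.of_nonneg_of_le (fun m => ?_) (fun m => ?_)
    (hsum.mul_left ((1 - y / R)⁻¹ * y⁻¹))
  · have := moment_pos h (2 * (m + 1) + 1)
    positivity
  · have hm := moment_pos h (2 * (m + 1) + 1)
    -- The factor `m + 1` is paid for by moving from the radius `y` to `R`, where the
    -- undifferentiated series still converges.
    have h1 := pow_mul_pow_le_factorial (s := y / R) (t := ((m + 1 : ℕ) : ℝ) * (1 - y / R))
      (n := m + 1) (j := 1) (by positivity) (by positivity) le_rfl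
    rw [pow_one, Nat.factorial_one, Nat.cast_one, div_pow, div_mul_eq_mul_div,
      div_le_one (by positivity)] at h1
    push_cast at h1
    rw [← mul_div_assoc]
    refine div_le_div_of_nonneg_right ?_ (by positivity)
    rw [← mul_inv, inv_mul_eq_div, le_div_iff₀ (by positivity)]
    calc (m + 1) * x ^ m * ((1 - y / R) * y) ≤ (m + 1) * y ^ m * ((1 - y / R) * y) := by gcongr
      _ = y ^ (m + 1) * ((m + 1) * (1 - y / R)) := by ring
      _ ≤ _ := h1

theorem differentiableOn_bergmanProjection_and_deriv {ω : ℝ → ℝ} (h : IsRadialWeight ω)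
    {f : ℂ → ℂ} (hf : Integrable (fun ζ => f ζ * (ω ‖ζ‖ : ℂ)) areaMeasure) :
    DifferentiableOn ℂ (bergmanProjection ω f) disc ∧ ∀ z ∈ disc,
      deriv (bergmanProjection ω f) z = ∫ ζ : ℂ,
        (∑' m : ℕ, ((m + 1) * z ^ m / (2 * (moment ω (2 * (m + 1) + 1) : ℂ))) * conj ζ ^ m)
          * (conj ζ * (f ζ * (ω ‖ζ‖ : ℂ))) ∂areaMeasure := by
  set μ : ℕ → ℂ := fun n => ∫ ζ : ℂ, conj ζ ^ n * (f ζ * (ω ‖ζ‖ : ℂ)) ∂areaMeasure with hμ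
  set M : ℝ := ∫ ζ, ‖f ζ * (ω ‖ζ‖ : ℂ)‖ ∂areaMeasure
  set F : ℕ → ℂ → ℂ := fun n z => z ^ n / (2 * (moment ω (2 * n + 1) : ℂ)) * μ n with hF
  have hμM : ∀ n, ‖μ n‖ ≤ M := fun n =>
    (norm_integral_le_integral_norm _).trans (norm_integral_conj_pow_mul_le hf n)
  have hFd : ∀ (n : ℕ) (U : Set ℂ), DifferentiableOn ℂ (F n) U := fun n U => by
    simp only [hF]
    fun_prop
  have hFle : ∀ (R : ℝ) (n : ℕ), ∀ w ∈ Metric.ball (0 : ℂ) R,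
      ‖F n w‖ ≤ R ^ n / (2 * moment ω (2 * n + 1)) * M := by
    intro R n w hw
    have hw' : ‖w‖ < R := by simpa using hw
    have := moment_pos h (2 * n + 1)
    simp only [hF]
    rw [norm_mul, norm_pow_div_moment h]
    have hM := hμM n
    have : 0 ≤ R := (norm_nonneg w).trans hw'.le
    gcongr
  have hEq : EqOn (bergmanProjection ω f) (fun w => ∑' n, F n w) disc := fun w hw =>
    (hasSum_bergmanProjection h hf hw).tsum_eq.symm
  have hloc : ∀ z ∈ disc, ∃ R : ℝ, z ∈ Metric.ball (0 : ℂ) R ∧ 0 ≤ R ∧ R < 1 := fun z hz => by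
    refine ⟨(1 + ‖z‖) / 2, ?_, by positivity, ?_⟩ <;> have := norm_lt_one hz
    · simp; linarith
    · linarith
  constructor
  · intro z hz
    obtain ⟨R, hzR, hR0, hR1⟩ := hloc z hz
    have hd := Complex.differentiableOn_tsum_of_summable_norm
      ((summable_pow_div_moment h hR0 hR1).mul_right M) (fun n => hFd n _)
      Metric.isOpen_ball (hFle R)
    have hsub : Metric.ball (0 : ℂ) R ⊆ disc := Metric.ball_subset_ball hR1.le
    exact ((hd.congr fun w hw => hEq (hsub hw)).differentiableAt
      (Metric.isOpen_ball.mem_nhds hzR)).differentiableWithinAt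
  · intro z hz
    obtain ⟨R, hzR, hR0, hR1⟩ := hloc z hz
    have hd := Complex.hasSum_deriv_of_summable_norm
      ((summable_pow_div_moment h hR0 hR1).mul_right M) (fun n => hFd n _)
      Metric.isOpen_ball (hFle R) hzR
    have he : deriv (bergmanProjection ω f) z = deriv (fun w => ∑' n, F n w) z :=
      (hEq.eventuallyEq_of_mem (Metric.isOpen_ball.mem_nhds hz)).deriv_eq
    rw [← he] at hd
    have hder : ∀ n, deriv (F n) z = n * z ^ (n - 1) / (2 * (moment ω (2 * n + 1) : ℂ)) * μ n := by
      intro n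
      simp only [hF]
      rw [deriv_mul_const (by fun_prop), deriv_div_const]
      simp
    simp only [hder] at hd
    -- The constant term has derivative zero; dropping it shifts the index, and the spare factor
    -- `conj ζ` is moved into the integrated function.
    have hd1 := (hasSum_nat_add_iff' 1).2 hd
    simp only [Finset.range_one, Finset.sum_singleton, Nat.cast_zero, zero_mul, zero_div,
      sub_zero, Nat.add_sub_cancel] at hd1
    have hg : Integrable (fun ζ : ℂ => conj ζ * (f ζ * (ω ‖ζ‖ : ℂ))) areaMeasure := by
      simpa using integrable_conj_pow_mul hf 1
    have hs : Summable fun m : ℕ =>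
        ‖(m + 1) * z ^ m / (2 * (moment ω (2 * (m + 1) + 1) : ℂ))‖ := by
      refine (summable_succ_mul_pow_div_moment h (norm_nonneg z) (norm_lt_one hz)).congr
        fun m => ?_
      have := moment_pos h (2 * (m + 1) + 1)
      have h1 : ‖(m : ℂ) + 1‖ = m + 1 := by exact_mod_cast Complex.norm_natCast (m + 1)
      simp [abs_of_pos this, h1]
    refine hd1.unique ?_
    have h2 := hasSum_integral_conj_series hs hg
    have hp : ∀ (m : ℕ) (ζ : ℂ), conj ζ ^ m * (conj ζ * (f ζ * (ω ‖ζ‖ : ℂ)))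
        = conj ζ ^ (m + 1) * (f ζ * (ω ‖ζ‖ : ℂ)) := fun m ζ => by ring
    simp only [hp] at h2
    simp only [hμ, Nat.cast_add, Nat.cast_one]
    exact h2

/-! ### Absolutely convergent power series on circles -/

/-- The unimodular function `θ ↦ e^{iθ}`. -/
noncomputable def unimod (θ : ℝ) : ℂ := Complex.exp (θ * Complex.I)

theorem norm_unimod (θ : ℝ) : ‖unimod θ‖ = 1 := Complex.norm_exp_ofReal_mul_I θ

@[fun_prop]
theorem continuous_unimod : Continuous unimod := by
  unfold unimod
  fun_prop

theorem integral_unimod_pow_mul_conj_pow (m n : ℕ) :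
    ∫ θ in Ioo (-Real.pi) Real.pi, unimod θ ^ m * conj (unimod θ) ^ n
      = if m = n then 2 * (Real.pi : ℂ) else 0 := by
  have hpi := Real.pi_pos
  rw [← integral_Ioc_eq_integral_Ioo, ← intervalIntegral.integral_of_le (by linarith)]
  have he : ∀ θ : ℝ, unimod θ ^ m * conj (unimod θ) ^ n
      = Complex.exp ((((m : ℂ) - n) * Complex.I) * θ) := fun θ => by
    simp only [unimod, ← Complex.exp_conj, ← Complex.exp_nat_mul, map_mul, Complex.conj_ofReal,
      Complex.conj_I, ← Complex.exp_add]
    congr 1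
    ring
  simp only [he]
  split_ifs with hmn
  · subst hmn
    simp
    ring
  · have hc : ((m : ℂ) - n) * Complex.I ≠ 0 :=
      mul_ne_zero (sub_ne_zero.2 (by exact_mod_cast hmn)) Complex.I_ne_zero
    rw [integral_exp_mul_complex hc, div_eq_zero_iff, sub_eq_zero]
    left
    rw [Complex.exp_eq_exp_iff_exists_int]
    refine ⟨(m : ℤ) - n, ?_⟩
    push_cast
    ring

theorem hasSum_integral_unimod_series {d : ℕ → ℂ} (hd : Summable fun n => ‖d n‖) {g : ℝ → ℂ}
    (hg : IntegrableOn g (Ioo (-Real.pi) Real.pi)) :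
    HasSum (fun n => d n * ∫ θ in Ioo (-Real.pi) Real.pi, unimod θ ^ n * g θ)
      (∫ θ in Ioo (-Real.pi) Real.pi, (∑' n, d n * unimod θ ^ n) * g θ) := by
  have hb : ∀ n : ℕ, IntegrableOn (fun θ => unimod θ ^ n * g θ) (Ioo (-Real.pi) Real.pi) :=
    fun n => hg.bdd_mul (f := fun θ => unimod θ ^ n) (c := 1)
      (by fun_prop) (Eventually.of_forall fun θ => by simp [norm_unimod])
  have hsum := hasSum_integral_of_summable_integral_norm
    (μ := volume.restrict (Ioo (-Real.pi) Real.pi))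
    (F := fun (n : ℕ) (θ : ℝ) => d n * (unimod θ ^ n * g θ))
    (fun n => (hb n).const_mul _) (by
      simpa [norm_unimod, integral_const_mul] using hd.mul_right
        (∫ θ in Ioo (-Real.pi) Real.pi, ‖g θ‖))
  simp only [integral_const_mul] at hsum
  have he : ∫ θ in Ioo (-Real.pi) Real.pi, (∑' n, d n * unimod θ ^ n) * g θ
      = ∫ θ in Ioo (-Real.pi) Real.pi, ∑' n, d n * (unimod θ ^ n * g θ) :=
    integral_congr_ae (Eventually.of_forall fun θ => by
      simp only [← tsum_mul_right, mul_assoc])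
  rw [he]
  exact hsum

theorem continuous_unimod_series {d : ℕ → ℂ} (hd : Summable fun n => ‖d n‖) :
    Continuous fun θ : ℝ => ∑' n, d n * unimod θ ^ n :=
  continuous_tsum (fun n => by fun_prop) hd fun n θ => by simp [norm_unimod]

theorem integrableOn_of_continuous {E : Type*} [NormedAddCommGroup E] {g : ℝ → E}
    (hg : Continuous g) : IntegrableOn g (Ioo (-Real.pi) Real.pi) :=
  (hg.integrableOn_Icc).mono_set Ioo_subset_Icc_self

/-- Parseval's identity: integrate the series termwise against its own conjugate, whose Fourier
coefficients come from orthogonality. -/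
theorem hasSum_integral_norm_sq_unimod_series {d : ℕ → ℂ} (hd : Summable fun n => ‖d n‖) :
    HasSum (fun n => 2 * Real.pi * ‖d n‖ ^ 2)
      (∫ θ in Ioo (-Real.pi) Real.pi, ‖∑' n, d n * unimod θ ^ n‖ ^ 2) := by
  set F : ℝ → ℂ := fun θ => ∑' n, d n * unimod θ ^ n with hF
  have hFc : Continuous F := continuous_unimod_series hd
  have hcoef : ∀ n : ℕ, ∫ θ in Ioo (-Real.pi) Real.pi, F θ * conj (unimod θ) ^ n
      = d n * (2 * Real.pi) := by
    intro n
    have h1 := hasSum_integral_unimod_series hd (g := fun θ => conj (unimod θ) ^ n)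
      (integrableOn_of_continuous (by fun_prop))
    simp only [integral_unimod_pow_mul_conj_pow] at h1
    refine h1.unique ?_
    convert hasSum_ite_eq n (d n * (2 * Real.pi)) using 2 with m
    split_ifs with hmn <;> simp [hmn]
  have h2 := hasSum_integral_unimod_series hd (g := fun θ => conj (F θ))
    (integrableOn_of_continuous (by fun_prop))
  have hc : ∀ n : ℕ, ∫ θ in Ioo (-Real.pi) Real.pi, unimod θ ^ n * conj (F θ)
      = conj (d n * (2 * Real.pi)) := by
    intro n
    rw [← hcoef, ← integral_conj]
    simp [mul_comm]
  simp only [hc] at h2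
  rw [← Complex.hasSum_ofReal]
  convert h2 using 2 with n
  · simp only [map_mul, Complex.conj_ofReal, map_ofNat, ← mul_assoc, Complex.mul_conj']
    push_cast
    ring
  · rw [← integral_complex_ofReal]
    refine integral_congr_ae (Eventually.of_forall fun θ => ?_)
    simp only [hF, Complex.mul_conj']
    push_cast
    rfl

/-- An `L¹` bound on the circle by the square sum of the differenced coefficients. -/
theorem integral_norm_unimod_series_le {a : ℕ → ℂ} {q : ℂ} (hq : ‖q‖ < 1)
    (ha : Summable fun n => ‖a n * q ^ n‖) {lam : ℝ} (hlam : 0 < lam) {S : ℝ}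
    (hS : HasSum (fun n => ‖(a n - if n = 0 then 0 else a (n - 1)) * q ^ n‖ ^ 2) S) :
    ∫ θ in Ioo (-Real.pi) Real.pi, ‖∑' n, a n * q ^ n * unimod θ ^ n‖
      ≤ Real.pi * (lam * S + lam⁻¹ * (1 - ‖q‖ ^ 2)⁻¹) := by
  set b : ℕ → ℂ := fun n => a n - if n = 0 then 0 else a (n - 1) with hb
  have hq2 : ‖q‖ ^ 2 < 1 := pow_lt_one₀ (norm_nonneg q) hq two_ne_zero
  have hshift : Summable fun n => ‖(if n = 0 then 0 else a (n - 1)) * q ^ n‖ := by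
    rw [← summable_nat_add_iff 1]
    simpa [pow_succ, ← mul_assoc] using ha.mul_right ‖q‖
  have hbs : Summable fun n => ‖b n * q ^ n‖ := by
    refine Summable.of_nonneg_of_le (fun _ => norm_nonneg _) (fun n => ?_) (ha.add hshift)
    simp only [hb, sub_mul]
    exact norm_sub_le _ _
  have hgs : Summable fun n => ‖q ^ n‖ := by
    simpa using summable_geometric_of_lt_one (norm_nonneg q) hq
  set F : ℝ → ℂ := fun θ => ∑' n, a n * q ^ n * unimod θ ^ n with hF
  set G : ℝ → ℂ := fun θ => ∑' n, b n * q ^ n * unimod θ ^ n with hG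
  set P : ℝ → ℂ := fun θ => ∑' n, q ^ n * unimod θ ^ n with hP
  have hFc : Continuous F := continuous_unimod_series ha
  have hGc : Continuous G := continuous_unimod_series hbs
  have hPc : Continuous P := continuous_unimod_series hgs
  -- Multiplication by `1 - q e^{iθ}` turns `F` into the series `G` of differenced coefficients, and
  -- `P` is the geometric series inverting that factor.
  have hprod : ∀ θ, F θ = G θ * P θ := by
    intro θ
    have hqu : ‖q * unimod θ‖ < 1 := by simpa [norm_unimod] using hq
    have hPe : P θ = (1 - q * unimod θ)⁻¹ := by
      simp only [hP, ← mul_pow]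
      exact tsum_geometric_of_norm_lt_one hqu
    have hne : 1 - q * unimod θ ≠ 0 := by
      intro h0
      rw [sub_eq_zero] at h0
      rw [← h0] at hqu
      simp at hqu
    have has : Summable fun n => a n * q ^ n * unimod θ ^ n :=
      Summable.of_norm (by simpa [norm_unimod] using ha)
    have hss : Summable fun n => (if n = 0 then 0 else a (n - 1)) * q ^ n * unimod θ ^ n :=
      Summable.of_norm (hshift.congr fun n => by
        rw [norm_mul _ (unimod θ ^ n), norm_pow, norm_unimod, one_pow, mul_one])
    have hGe : G θ = F θ - (q * unimod θ) * F θ := by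
      have h1 : ∑' n, (if n = 0 then 0 else a (n - 1)) * q ^ n * unimod θ ^ n
          = (q * unimod θ) * F θ := by
        rw [hss.tsum_eq_zero_add]
        simp only [hF, ← tsum_mul_left]
        simp only [if_true, zero_mul, zero_add, Nat.add_eq_zero_iff, one_ne_zero, and_false,
          if_false, Nat.add_sub_cancel]
        refine tsum_congr fun n => ?_
        ring
      rw [← h1]
      simp only [hG, hF, hb, sub_mul]
      exact has.tsum_sub hss
    rw [hGe, hPe]
    field_simp
  have hSG : ∫ θ in Ioo (-Real.pi) Real.pi, ‖G θ‖ ^ 2 = 2 * Real.pi * S :=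
    (hasSum_integral_norm_sq_unimod_series hbs).unique (hS.mul_left _)
  have hSP : ∫ θ in Ioo (-Real.pi) Real.pi, ‖P θ‖ ^ 2 = 2 * Real.pi * (1 - ‖q‖ ^ 2)⁻¹ := by
    refine (hasSum_integral_norm_sq_unimod_series hgs).unique ?_
    simp only [norm_pow, ← pow_mul, mul_comm _ 2]
    simp only [pow_mul]
    exact (hasSum_geometric_of_lt_one (by positivity) hq2).mul_left _
  calc ∫ θ in Ioo (-Real.pi) Real.pi, ‖F θ‖
      ≤ ∫ θ in Ioo (-Real.pi) Real.pi, (lam / 2 * ‖G θ‖ ^ 2 + lam⁻¹ / 2 * ‖P θ‖ ^ 2) := by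
        refine integral_mono (integrableOn_of_continuous (by fun_prop))
          (integrableOn_of_continuous (by fun_prop)) fun θ => ?_
        simp only [hprod, norm_mul]
        -- Young's inequality with a free parameter replaces Cauchy–Schwarz.
        have h3 : lam / 2 * ‖G θ‖ ^ 2 + lam⁻¹ / 2 * ‖P θ‖ ^ 2 - ‖G θ‖ * ‖P θ‖
            = lam / 2 * (‖G θ‖ - lam⁻¹ * ‖P θ‖) ^ 2 := by
          field_simp
          ring
        have h4 : 0 ≤ lam / 2 * (‖G θ‖ - lam⁻¹ * ‖P θ‖) ^ 2 := by positivity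
        linarith
    _ = Real.pi * (lam * S + lam⁻¹ * (1 - ‖q‖ ^ 2)⁻¹) := by
        rw [integral_add (integrableOn_of_continuous (by fun_prop))
          (integrableOn_of_continuous (by fun_prop)), integral_const_mul, integral_const_mul,
          hSG, hSP]
        ring

/-! ### The weight `ν ν̂` -/

theorem integral_div_tail_sq_le_of_le {ν : ℝ → ℝ} (h : IsRadialWeight ν) {y x : ℝ} (hy : 0 ≤ y)
    (hyx : y ≤ x) (hx : x < 1) :
    ∫ s in y..x, ν s / tail ν s ^ 2 ≤ tail ν y / tail ν x ^ 2 := by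
  have hyI : y ∈ Icc (0 : ℝ) 1 := ⟨hy, (hyx.trans_lt hx).le⟩
  have hxI : x ∈ Icc (0 : ℝ) 1 := ⟨hy.trans hyx, hx.le⟩
  have hi := h.intervalIntegrable hyI hxI
  have hvx := h.tail_pos x ⟨hxI.1, hx⟩
  have hnn : ∀ s ∈ Ioc y x, 0 ≤ ν s := fun s hs => h.nonneg s ⟨hy.trans hs.1.le, hs.2.trans_lt hx⟩
  have hle : ∀ s ∈ Ioc y x, tail ν x ≤ tail ν s := fun s hs =>
    tail_le_tail h (hy.trans hs.1.le) hs.2 hx.le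
  calc ∫ s in y..x, ν s / tail ν s ^ 2 ≤ ∫ s in y..x, ν s / tail ν x ^ 2 := by
        rw [intervalIntegral.integral_of_le hyx, intervalIntegral.integral_of_le hyx]
        refine integral_mono_of_nonneg ?_ (hi.1.div_const _) ?_ <;>
          refine (ae_restrict_mem measurableSet_Ioc).mono fun s hs => ?_
        · exact div_nonneg (hnn s hs) (sq_nonneg _)
        · exact div_le_div_of_nonneg_left (hnn s hs) (by positivity)
            (pow_le_pow_left₀ hvx.le (hle s hs) 2)
    _ = (tail ν y - tail ν x) / tail ν x ^ 2 := by
        rw [intervalIntegral.integral_div, tail_sub h hyI hxI]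
    _ ≤ _ := by gcongr; linarith

/-- Freezing the denominator at `r` keeps it away from zero up to the endpoint 1. -/
theorem intervalIntegrable_div_tail_min_sq {ν : ℝ → ℝ} (h : IsRadialWeight ν) {r : ℝ}
    (hr : r ∈ Ico (0 : ℝ) 1) :
    IntervalIntegrable (fun s => ν s / tail ν (min s r) ^ 2) volume 0 1 := by
  have h1 := h.intervalIntegrable (a := 0) (b := 1) (by simp) (by simp)
  have hm : ∀ s ∈ Icc (0 : ℝ) 1, min s r ∈ Ico (0 : ℝ) 1 := fun s hs =>
    ⟨le_min hs.1 hr.1, (min_le_right _ _).trans_lt hr.2⟩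
  have hc : ContinuousOn (fun s => (tail ν (min s r) ^ 2)⁻¹) (uIcc 0 1) := by
    rw [uIcc_of_le zero_le_one]
    have h2 : ContinuousOn (fun s => tail ν (min s r)) (Icc 0 1) :=
      (tail_continuousOn h).comp (by fun_prop) fun s hs => Ico_subset_Icc_self (hm s hs)
    exact (h2.pow 2).inv₀ fun s hs => (pow_pos (h.tail_pos _ (hm s hs)) 2).ne'
  simpa only [div_eq_mul_inv] using h1.mul_continuousOn hc

/-- Formally `1 / ν̂` is an antiderivative, but a dyadic decomposition avoids differentiating `ν̂`.
Choose `y` with `ν̂ y = 2 ν̂ x`: the piece over `[y, x]` contributes at most `2 / ν̂ x`, and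
induction gives `4 / ν̂ y = 2 / ν̂ x` for the rest. -/
theorem integral_div_tail_sq_le {ν : ℝ → ℝ} (h : IsRadialWeight ν) {x : ℝ}
    (hx : x ∈ Ico (0 : ℝ) 1) : ∫ s in (0 : ℝ)..x, ν s / tail ν s ^ 2 ≤ 4 / tail ν x := by
  have key : ∀ k : ℕ, ∀ x ∈ Ico (0 : ℝ) 1, tail ν 0 ≤ 2 ^ k * tail ν x →
      ∫ s in (0 : ℝ)..x, ν s / tail ν s ^ 2 ≤ 4 / tail ν x := by
    intro k
    induction k with
    | zero =>
      intro x hx hk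
      have hvx := h.tail_pos x hx
      refine (integral_div_tail_sq_le_of_le h le_rfl hx.1 hx.2).trans ?_
      rw [div_le_div_iff₀ (by positivity) hvx]
      nlinarith
    | succ k ih =>
      intro x hx hk
      have hvx := h.tail_pos x hx
      rcases le_total (tail ν 0) (2 * tail ν x) with hc | hc
      · refine (integral_div_tail_sq_le_of_le h le_rfl hx.1 hx.2).trans ?_
        rw [div_le_div_iff₀ (by positivity) hvx]
        nlinarith
      · obtain ⟨y, hy, hyv⟩ := exists_tail_eq h le_rfl hx.1 hx.2.le
          (y := 2 * tail ν x) ⟨by linarith, hc⟩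
        have hyI : y ∈ Ico (0 : ℝ) 1 := ⟨hy.1, hy.2.trans_lt hx.2⟩
        have h1 := ih y hyI (by rw [hyv]; rw [pow_succ] at hk; linarith)
        have h2 := integral_div_tail_sq_le_of_le h hy.1 hy.2 hx.2
        have hint : IntervalIntegrable (fun s => ν s / tail ν s ^ 2) volume 0 x := by
          have h3 := (intervalIntegrable_div_tail_min_sq h hx).mono_set (c := 0) (d := x) (by
            rw [uIcc_of_le zero_le_one, uIcc_of_le hx.1]
            exact Icc_subset_Icc_right hx.2.le)
          refine h3.congr fun s hs => ?_
          rw [uIoc_of_le hx.1] at hs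
          simp only [min_eq_left hs.2]
        have h3 := intervalIntegral.integral_add_adjacent_intervals
          (hint.mono_set (c := 0) (d := y) (by
            rw [uIcc_of_le hx.1, uIcc_of_le hy.1]; exact Icc_subset_Icc_right hy.2))
          (hint.mono_set (c := y) (d := x) (by
            rw [uIcc_of_le hx.1, uIcc_of_le hy.2]; exact Icc_subset_Icc_left hy.1))
        rw [← h3]
        refine (add_le_add h1 h2).trans_eq ?_
        rw [hyv]
        field_simp
        norm_num
  have hvx := h.tail_pos x hx
  obtain ⟨k, hk⟩ := pow_unbounded_of_one_lt (tail ν 0 / tail ν x) (one_lt_two (α := ℝ))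
  exact key k x hx (by rw [div_lt_iff₀ hvx] at hk; exact hk.le)

theorem integral_div_tail_min_sq_le {ν : ℝ → ℝ} (h : IsRadialWeight ν) {r : ℝ}
    (hr : r ∈ Ico (0 : ℝ) 1) :
    ∫ s in Ioo (0 : ℝ) 1, ν s / tail ν (min s r) ^ 2 ≤ 5 / tail ν r := by
  have hi := intervalIntegrable_div_tail_min_sq h hr
  have hv := h.tail_pos r hr
  rw [← integral_Ioc_eq_integral_Ioo, ← intervalIntegral.integral_of_le zero_le_one,
    ← intervalIntegral.integral_add_adjacent_intervals (b := r)
      (hi.mono_set (by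
        rw [uIcc_of_le zero_le_one, uIcc_of_le hr.1]; exact Icc_subset_Icc_right hr.2.le))
      (hi.mono_set (by
        rw [uIcc_of_le zero_le_one, uIcc_of_le hr.2.le]; exact Icc_subset_Icc_left hr.1))]
  have h1 : ∫ s in (0 : ℝ)..r, ν s / tail ν (min s r) ^ 2
      = ∫ s in (0 : ℝ)..r, ν s / tail ν s ^ 2 := by
    refine intervalIntegral.integral_congr fun s hs => ?_
    rw [uIcc_of_le hr.1] at hs
    simp only [min_eq_left hs.2]
  have h2 : ∫ s in r..1, ν s / tail ν (min s r) ^ 2 = ∫ s in r..1, ν s / tail ν r ^ 2 := by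
    refine intervalIntegral.integral_congr fun s hs => ?_
    rw [uIcc_of_le hr.2.le] at hs
    simp only [min_eq_right hs.1]
  have h3 := integral_div_tail_sq_le h hr
  rw [h1, h2, intervalIntegral.integral_div]
  have h4 : (∫ s in r..1, ν s) / tail ν r ^ 2 = 1 / tail ν r := by
    change tail ν r / tail ν r ^ 2 = _
    field_simp
  rw [h4]
  refine (add_le_add_left h3 _).trans_eq ?_
  ring

theorem integrableOn_mul_tail {ν : ℝ → ℝ} (h : IsRadialWeight ν) :
    IntegrableOn (fun r => ν r * tail ν r) (Ico (0 : ℝ) 1) := by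
  have h1 := h.intervalIntegrable (a := 0) (b := 1) (by simp) (by simp)
  have hc : ContinuousOn (tail ν) (uIcc 0 1) := by
    rw [uIcc_of_le zero_le_one]
    exact tail_continuousOn h
  exact (intervalIntegrable_iff_integrableOn_Ico_of_le zero_le_one).1 (h1.mul_continuousOn hc)

/-- Cut at the point `s` where `ν̂` has halved: `[r, s]` carries half of the mass of `ν` beyond `r`,
and there `ν̂` is at least `ν̂ r / 2`. -/
theorem tail_sq_div_four_le {ν : ℝ → ℝ} (h : IsRadialWeight ν) {r : ℝ}
    (hr : r ∈ Ico (0 : ℝ) 1) : tail ν r ^ 2 / 4 ≤ tail (fun r => ν r * tail ν r) r := by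
  have hv := h.tail_pos r hr
  obtain ⟨s, hs, hsv⟩ := exists_tail_eq h hr.1 hr.2.le le_rfl (y := tail ν r / 2)
    ⟨by rw [tail_one]; positivity, by linarith⟩
  have hint : IntegrableOn (fun r => ν r * tail ν r) (Ioc r 1) := by
    rw [integrableOn_Ioc_iff_integrableOn_Ioo]
    exact (integrableOn_mul_tail h).mono_set fun t ht => ⟨hr.1.trans ht.1.le, ht.2⟩
  have hs0 : 0 ≤ s := hr.1.trans hs.1
  have hnn : ∀ t ∈ Ioo r 1, 0 ≤ ν t * tail ν t := fun t ht =>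
    mul_nonneg (h.nonneg t ⟨hr.1.trans ht.1.le, ht.2⟩)
      (h.tail_pos t ⟨hr.1.trans ht.1.le, ht.2⟩).le
  have hs1 : s < 1 := lt_of_le_of_ne hs.2 fun h1 => by rw [h1, tail_one] at hsv; linarith
  calc tail ν r ^ 2 / 4 = (tail ν r - tail ν s) * tail ν s := by rw [hsv]; ring
    _ = ∫ t in Ioc r s, ν t * tail ν s := by
        rw [integral_mul_const, ← intervalIntegral.integral_of_le hs.1,
          tail_sub h ⟨hr.1, hr.2.le⟩ ⟨hs0, hs.2⟩]
    _ ≤ ∫ t in Ioc r s, ν t * tail ν t := by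
        refine setIntegral_mono_on
          ((h.intervalIntegrable ⟨hr.1, hr.2.le⟩ ⟨hs0, hs.2⟩).1.mul_const _)
          (hint.mono_set (Ioc_subset_Ioc_right hs.2)) measurableSet_Ioc fun t ht => ?_
        exact mul_le_mul_of_nonneg_left (tail_le_tail h (hr.1.trans ht.1.le) ht.2 hs.2)
          (h.nonneg t ⟨hr.1.trans ht.1.le, ht.2.trans_lt hs1⟩)
    _ ≤ ∫ t in Ioo r 1, ν t * tail ν t := by
        refine setIntegral_mono_set (hint.mono_set Ioo_subset_Ioc_self) ?_
          (Ioc_subset_Ioo_right hs1).eventuallyLE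
        exact (ae_restrict_mem measurableSet_Ioo).mono hnn
    _ = _ := by
        rw [tail, intervalIntegral.integral_of_le hr.2.le, integral_Ioc_eq_integral_Ioo]

theorem isRadialWeight_mul_tail {ν : ℝ → ℝ} (h : IsRadialWeight ν) :
    IsRadialWeight fun r => ν r * tail ν r where
  nonneg r hr := mul_nonneg (h.nonneg r hr) (h.tail_pos r hr).le
  integrableOn := integrableOn_mul_tail h
  tail_pos r hr := by
    have := h.tail_pos r hr
    exact lt_of_lt_of_le (by positivity) (tail_sq_div_four_le h hr)

/-- For `r ≥ 1 / 2` one has `-log r ≤ 1 / r - 1 ≤ 2 (1 - r)`. -/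
theorem exp_neg_le_pow {r L : ℝ} {n : ℕ} (hr : 1 / 2 ≤ r) (hr1 : r ≤ 1)
    (hn : n * (1 - r) ≤ L) : Real.exp (-(2 * L)) ≤ r ^ n := by
  have hrp : 0 < r := by linarith
  have h1 : Real.exp (-(2 * (1 - r))) ≤ r := by
    have h2 := Real.add_one_le_exp (1 / r - 1)
    rw [sub_add_cancel] at h2
    have h3 : Real.exp (1 / r - 1) ≤ Real.exp (2 * (1 - r)) := by
      refine Real.exp_le_exp.2 ?_
      rw [div_sub_one hrp.ne', div_le_iff₀ hrp]
      nlinarith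
    rw [Real.exp_neg, inv_le_comm₀ (Real.exp_pos _) hrp, ← one_div]
    exact h2.trans h3
  calc Real.exp (-(2 * L)) ≤ Real.exp (n * -(2 * (1 - r))) := Real.exp_le_exp.2 (by linarith)
    _ = Real.exp (-(2 * (1 - r))) ^ n := by rw [Real.exp_nat_mul]
    _ ≤ r ^ n := by gcongr

theorem le_moment_mul_tail {ν : ℝ → ℝ} (h : IsRadialWeight ν) {n : ℕ} {r : ℝ} (hr : 1 / 2 ≤ r)
    (hr1 : r < 1) (hn : n * (1 - r) ≤ 2) :
    Real.exp (-(2 * 2)) / 4 * tail ν r ^ 2 ≤ moment (fun r => ν r * tail ν r) n := by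
  have hr0 : r ∈ Ico (0 : ℝ) 1 := ⟨by linarith, hr1⟩
  refine le_trans ?_ (pow_mul_tail_le_moment (isRadialWeight_mul_tail h) n hr0)
  calc Real.exp (-(2 * 2)) / 4 * tail ν r ^ 2 = Real.exp (-(2 * 2)) * (tail ν r ^ 2 / 4) := by ring
    _ ≤ _ := mul_le_mul (exp_neg_le_pow hr hr1.le hn) (tail_sq_div_four_le h hr0)
      (by positivity) (pow_nonneg hr0.1 n)

/-- Converse of `le_moment_mul_tail`. The cube of `ν̂ r` is aimed at because the comparison density
`ν s / ν̂ (min s r) ^ 2` has integral of order `1 / ν̂ r`, leaving a square. -/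
theorem UpperDoubling.exists_moment_mul_tail_le {ν : ℝ → ℝ} (h : UpperDoubling ν) :
    ∃ C : ℝ, 0 < C ∧ ∀ n : ℕ, ∀ r ∈ Ico (0 : ℝ) 1, 1 ≤ 2 * n * (1 - r) →
      moment (fun r => ν r * tail ν r) n ≤ C * tail ν r ^ 2 := by
  obtain ⟨C, hC, hb⟩ := h.exists_pow_mul_tail_pow_le 3
  refine ⟨(1 + C) * 5, by positivity, fun n r hr hn => ?_⟩
  have hv := h.1.tail_pos r hr
  have hi : IntegrableOn (fun s => ν s / tail ν (min s r) ^ 2) (Ioo 0 1) :=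
    (intervalIntegrable_div_tail_min_sq h.1 hr).1.mono_set Ioo_subset_Ioc_self
  rw [moment_eq]
  calc ∫ s in Ioo (0 : ℝ) 1, s ^ n * (ν s * tail ν s)
      ≤ ∫ s in Ioo (0 : ℝ) 1, (1 + C) * tail ν r ^ 3 * (ν s / tail ν (min s r) ^ 2) := by
        refine setIntegral_mono_on
          (integrableOn_pow_mul (isRadialWeight_mul_tail h.1) n) (hi.const_mul _)
          measurableSet_Ioo fun s hs => ?_
        have hsI : s ∈ Ico (0 : ℝ) 1 := ⟨hs.1.le, hs.2⟩
        have hvs := h.1.tail_pos s hsI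
        have hmin : 0 < tail ν (min s r) := by
          rcases min_choice s r with h1 | h1 <;> rw [h1] <;> assumption
        have hkey : s ^ n * tail ν s * tail ν (min s r) ^ 2 ≤ (1 + C) * tail ν r ^ 3 := by
          have hpos : 0 ≤ tail ν r ^ 3 := by positivity
          rcases le_total s r with hsr | hsr
          · rw [min_eq_left hsr]
            have := hb n s hsI r hr hn
            linarith
          · rw [min_eq_right hsr]
            have h1 := tail_le_tail h.1 hr.1 hsr hs.2.le
            have h2 : s ^ n ≤ 1 := pow_le_one₀ hs.1.le hs.2.le
            calc s ^ n * tail ν s * tail ν r ^ 2 ≤ 1 * tail ν r * tail ν r ^ 2 := by gcongr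
              _ = tail ν r ^ 3 := by ring
              _ ≤ _ := by nlinarith
        calc s ^ n * (ν s * tail ν s)
            = ν s / tail ν (min s r) ^ 2 * (s ^ n * tail ν s * tail ν (min s r) ^ 2) := by
              field_simp
          _ ≤ ν s / tail ν (min s r) ^ 2 * ((1 + C) * tail ν r ^ 3) :=
              mul_le_mul_of_nonneg_left hkey (div_nonneg (h.1.nonneg s hsI) (sq_nonneg _))
          _ = _ := by ring
    _ = (1 + C) * tail ν r ^ 3 * ∫ s in Ioo (0 : ℝ) 1, ν s / tail ν (min s r) ^ 2 :=
        integral_const_mul _ _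
    _ ≤ (1 + C) * tail ν r ^ 3 * (5 / tail ν r) := by
        gcongr
        exact integral_div_tail_min_sq_le h.1 hr
    _ = _ := by field_simp

/-! ### The differentiated kernel of `ν ν̂` in `L¹` on circles -/

/-- The Taylor coefficients of the differentiated kernel. -/
noncomputable def derivCoeff (ω : ℝ → ℝ) (m : ℕ) : ℝ := (m + 1) / (2 * moment ω (2 * (m + 1) + 1))

/-- Subtracting moments produces `1 - s ^ 2 = (1 - s)(1 + s)`. Half of the power of `s` pays for `m
(1 - s)`, and the other half stays in the moment on the right. -/
theorem nat_mul_moment_sub_moment_le {ω : ℝ → ℝ} (h : IsRadialWeight ω) (m : ℕ) :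
    m * (moment ω (2 * m + 1) - moment ω (2 * (m + 1) + 1)) ≤ 2 * moment ω (m + 1) := by
  have h1 := integrableOn_pow_mul h (2 * m + 1)
  have h2 := integrableOn_pow_mul h (2 * (m + 1) + 1)
  rw [moment_eq, moment_eq, moment_eq, ← integral_sub h1 h2, ← integral_const_mul,
    ← integral_const_mul]
  refine setIntegral_mono_on ((h1.sub h2).const_mul _) ((integrableOn_pow_mul h _).const_mul _)
    measurableSet_Ioo fun s hs => ?_
  have hω := h.nonneg s ⟨hs.1.le, hs.2⟩
  have hs0 := hs.1
  have hs1 := hs.2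
  have h3 := pow_mul_pow_le_factorial (s := s) (t := m * (1 - s)) (n := m) (j := 1) hs.1.le
    (mul_nonneg m.cast_nonneg (by linarith)) le_rfl
  simp only [pow_one, Nat.factorial_one, Nat.cast_one] at h3
  have h4 : s ^ m * (m * (1 - s)) * (1 + s) ≤ 2 := by
    have h5 : 0 ≤ s ^ m * (m * (1 - s)) :=
      mul_nonneg (by positivity) (mul_nonneg m.cast_nonneg (by linarith))
    nlinarith
  calc m * (s ^ (2 * m + 1) * ω s - s ^ (2 * (m + 1) + 1) * ω s)
      = s ^ (m + 1) * ω s * (s ^ m * (m * (1 - s)) * (1 + s)) := by ring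
    _ ≤ s ^ (m + 1) * ω s * 2 := by gcongr
    _ = _ := by ring

theorem moment_antitone {ω : ℝ → ℝ} (h : IsRadialWeight ω) : Antitone (moment ω) := by
  intro m n hmn
  rw [moment_eq, moment_eq]
  refine setIntegral_mono_on (integrableOn_pow_mul h _) (integrableOn_pow_mul h _)
    measurableSet_Ioo fun s hs => ?_
  exact mul_le_mul_of_nonneg_right (pow_le_pow_of_le_one hs.1.le hs.2.le hmn)
    (h.nonneg s ⟨hs.1.le, hs.2⟩)

/-- Differencing gains a factor `m`: what remains is `1 / ω_{2m+3}` and `m` times a difference of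
moments over their product, both of order `1 / ν̂ ^ 2`. -/
theorem UpperDoubling.exists_abs_derivCoeff_sub_le {ν : ℝ → ℝ} (h : UpperDoubling ν) :
    ∃ C : ℝ, 0 < C ∧ ∀ m : ℕ,
      |derivCoeff (fun r => ν r * tail ν r) m -
        if m = 0 then 0 else derivCoeff (fun r => ν r * tail ν r) (m - 1)|
      ≤ C / tail ν (1 - 1 / (m + 2)) ^ 2 := by
  obtain ⟨C, hC, hup⟩ := h.exists_moment_mul_tail_le
  set c : ℝ := Real.exp (-(2 * 2)) / 4
  have hc : 0 < c := by positivity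
  have hw := isRadialWeight_mul_tail h.1
  set ω : ℝ → ℝ := fun r => ν r * tail ν r
  refine ⟨1 / c + 2 * C / c ^ 2, by positivity, fun m => ?_⟩
  -- The shift by 2 gives `ρ ≥ 1 / 2` already at `m = 0` and suits all three moment estimates, of
  -- orders `2m+1`, `2m+3` and `m+1`.
  set ρ : ℝ := 1 - 1 / (m + 2) with hρ
  have hm0 : (0 : ℝ) ≤ m := m.cast_nonneg
  have h1ρ : 1 - ρ = 1 / (m + 2) := by rw [hρ]; ring
  have hρ1 : ρ < 1 := by
    have : (0 : ℝ) < 1 / (m + 2) := by positivity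
    linarith
  have hρ2 : 1 / 2 ≤ ρ := by
    have : (1 : ℝ) / (m + 2) ≤ 1 / 2 := by gcongr; linarith
    linarith
  have hρI : ρ ∈ Ico (0 : ℝ) 1 := ⟨by linarith, hρ1⟩
  have hv := h.1.tail_pos ρ hρI
  have hM1 : c * tail ν ρ ^ 2 ≤ moment ω (2 * m + 1) := by
    refine le_moment_mul_tail h.1 hρ2 hρ1 ?_
    rw [h1ρ, mul_one_div, div_le_iff₀ (by positivity)]
    push_cast
    linarith
  have hM3 : c * tail ν ρ ^ 2 ≤ moment ω (2 * (m + 1) + 1) := by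
    refine le_moment_mul_tail h.1 hρ2 hρ1 ?_
    rw [h1ρ, mul_one_div, div_le_iff₀ (by positivity)]
    push_cast
    linarith
  have hM : moment ω (m + 1) ≤ C * tail ν ρ ^ 2 := by
    refine hup _ ρ hρI ?_
    rw [h1ρ, mul_one_div, le_div_iff₀ (by positivity)]
    push_cast
    linarith
  have hdiff := nat_mul_moment_sub_moment_le hw m
  have hanti := moment_antitone hw (show 2 * m + 1 ≤ 2 * (m + 1) + 1 by lia)
  have hp1 := moment_pos hw (2 * m + 1)
  have hp3 := moment_pos hw (2 * (m + 1) + 1)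
  have hval : derivCoeff ω m - (if m = 0 then 0 else derivCoeff ω (m - 1))
      = (1 / 2) * (1 / moment ω (2 * (m + 1) + 1) + m * (moment ω (2 * m + 1)
        - moment ω (2 * (m + 1) + 1)) / (moment ω (2 * m + 1) * moment ω (2 * (m + 1) + 1))) := by
    have he : (if m = 0 then 0 else derivCoeff ω (m - 1)) = m / (2 * moment ω (2 * m + 1)) := by
      cases m with
      | zero => simp
      | succ k => simp [derivCoeff]
    rw [he, derivCoeff]
    field_simp
    ring
  rw [hval, abs_of_nonneg (by
    have : 0 ≤ moment ω (2 * m + 1) - moment ω (2 * (m + 1) + 1) := by linarith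
    positivity)]
  have hb1 : 1 / moment ω (2 * (m + 1) + 1) ≤ 1 / (c * tail ν ρ ^ 2) := by gcongr
  have hb2 : m * (moment ω (2 * m + 1) - moment ω (2 * (m + 1) + 1))
      / (moment ω (2 * m + 1) * moment ω (2 * (m + 1) + 1))
      ≤ 2 * (C * tail ν ρ ^ 2) / ((c * tail ν ρ ^ 2) * (c * tail ν ρ ^ 2)) := by
    have : m * (moment ω (2 * m + 1) - moment ω (2 * (m + 1) + 1)) ≤ 2 * (C * tail ν ρ ^ 2) := by
      linarith
    gcongr
  calc _ ≤ (1 / 2) * (1 / (c * tail ν ρ ^ 2)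
        + 2 * (C * tail ν ρ ^ 2) / ((c * tail ν ρ ^ 2) * (c * tail ν ρ ^ 2))) := by gcongr
    _ = (1 / 2) * ((1 / c + 2 * C / c ^ 2) / tail ν ρ ^ 2) := by field_simp
    _ ≤ _ := by
      have : 0 ≤ (1 / c + 2 * C / c ^ 2) / tail ν ρ ^ 2 := by positivity
      linarith

/-- Since `(m + 2) ^ k ≤ 2 ^ k k! C(m + k, k)`, the negative binomial series `∑ C(m + k, k) x ^ m =
(1 - x)^{-k-1}` gives the bound. -/
theorem exists_summable_tsum_pow_mul_le (k : ℕ) : ∃ C : ℝ, 0 < C ∧ ∀ x : ℝ, 0 ≤ x → x < 1 →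
    Summable (fun m : ℕ => (1 + ((m + 2) * (1 - x)) ^ k) * x ^ m) ∧
      ∑' m : ℕ, (1 + ((m + 2) * (1 - x)) ^ k) * x ^ m ≤ C / (1 - x) := by
  refine ⟨1 + 2 ^ k * k.factorial, by positivity, fun x hx0 hx1 => ?_⟩
  have hx : 0 < 1 - x := by linarith
  have hn : ‖x‖ < 1 := by rwa [Real.norm_of_nonneg hx0]
  have hle : ∀ m : ℕ, (1 + ((m + 2) * (1 - x)) ^ k) * x ^ m
      ≤ x ^ m + 2 ^ k * k.factorial * (1 - x) ^ k * (((m + k).choose k : ℝ) * x ^ m) := by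
    intro m
    have h1 : ((m : ℝ) + 1) ^ k ≤ k.factorial * (m + k).choose k := by
      exact_mod_cast (Nat.pow_succ_le_ascFactorial (m + 1) k).trans_eq
        (Nat.ascFactorial_eq_factorial_mul_choose m k)
    have h2 : ((m : ℝ) + 2) ^ k ≤ 2 ^ k * (k.factorial * (m + k).choose k) :=
      calc ((m : ℝ) + 2) ^ k ≤ (2 * (m + 1)) ^ k := by gcongr; linarith
        _ = 2 ^ k * (m + 1) ^ k := mul_pow _ _ _
        _ ≤ _ := by gcongr
    rw [mul_pow, add_mul, one_mul]
    calc x ^ m + (m + 2) ^ k * (1 - x) ^ k * x ^ m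
        ≤ x ^ m + 2 ^ k * (k.factorial * (m + k).choose k) * (1 - x) ^ k * x ^ m := by gcongr
      _ = _ := by ring
  have hs1 := hasSum_geometric_of_lt_one hx0 hx1
  have hs2 := ((summable_choose_mul_geometric_of_norm_lt_one k hn).hasSum).mul_left
    (2 ^ k * k.factorial * (1 - x) ^ k)
  rw [tsum_choose_mul_geometric_of_norm_lt_one k hn] at hs2
  have hs := hs1.add hs2
  have hsum := Summable.of_nonneg_of_le (fun m => by positivity) hle hs.summable
  refine ⟨hsum, (hsum.tsum_le_tsum hle hs.summable).trans_eq ?_⟩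
  rw [hs.tsum_eq]
  field_simp
  ring

theorem summable_derivCoeff {ω : ℝ → ℝ} (h : IsRadialWeight ω) {q : ℂ} (hq : ‖q‖ < 1) :
    Summable fun m => ‖(derivCoeff ω m : ℂ) * q ^ m‖ := by
  refine (summable_succ_mul_pow_div_moment h (norm_nonneg q) hq).congr fun m => ?_
  have := moment_pos h (2 * (m + 1) + 1)
  have h0 : 0 ≤ derivCoeff ω m := by unfold derivCoeff; positivity
  rw [norm_mul, norm_pow, Complex.norm_real, Real.norm_of_nonneg h0, derivCoeff]
  ring

/-- Polynomial doubling compares `ν̂` at `1 - 1 / (m + 2)` with `ν̂ x`, at the cost of powers of `(m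
+ 2)(1 - x)` that the geometric factor sums. The square sum of the differences is thus of order `1 /
(ν̂ x ^ 4 (1 - x))`. -/
theorem UpperDoubling.exists_integral_norm_derivKernel_le {ν : ℝ → ℝ} (h : UpperDoubling ν) :
    ∃ C : ℝ, 0 < C ∧ ∀ q : ℂ, ‖q‖ < 1 →
      ∫ θ in Ioo (-Real.pi) Real.pi,
        ‖∑' m : ℕ, (derivCoeff (fun r => ν r * tail ν r) m : ℂ) * q ^ m * unimod θ ^ m‖
      ≤ C / (tail ν ‖q‖ ^ 2 * (1 - ‖q‖)) := by
  obtain ⟨B, hB, hcoef⟩ := h.exists_abs_derivCoeff_sub_le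
  obtain ⟨A, hA, β, hdb⟩ := h.exists_tail_le_pow
  obtain ⟨D, hD, hsum⟩ := exists_summable_tsum_pow_mul_le (4 * β)
  set ω : ℝ → ℝ := fun r => ν r * tail ν r with hω
  have hw : IsRadialWeight ω := isRadialWeight_mul_tail h.1
  refine ⟨Real.pi * (B ^ 2 * A ^ 4 * D + 1), by have := Real.pi_pos; positivity, fun q hq => ?_⟩
  set x := ‖q‖ with hx
  have hx0 : 0 ≤ x := norm_nonneg q
  have hx' : 0 < 1 - x := by linarith
  have hv := h.1.tail_pos x ⟨hx0, hq⟩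
  obtain ⟨hs1, hs2⟩ := hsum x hx0 hq
  set b : ℕ → ℝ := fun m => derivCoeff ω m - if m = 0 then 0 else derivCoeff ω (m - 1)
  have hbm : ∀ m, |b m| ≤ B * A ^ 2 / tail ν x ^ 2 * (max 1 ((m + 2) * (1 - x))) ^ (2 * β) := by
    intro m
    have hm0 : (0 : ℝ) ≤ m := m.cast_nonneg
    set ρ : ℝ := 1 - 1 / (m + 2) with hρ
    have hρI : ρ ∈ Ico (0 : ℝ) 1 := by
      have h1 : (0 : ℝ) < 1 / (m + 2) := by positivity
      have h2 : (1 : ℝ) / (m + 2) ≤ 1 := by rw [div_le_one (by positivity)]; linarith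
      exact ⟨by linarith, by linarith⟩
    have hvρ := h.1.tail_pos ρ hρI
    set t : ℝ := max 1 ((m + 2) * (1 - x)) with ht
    have ht1 : 1 ≤ t := le_max_left _ _
    have h3 := hdb x ⟨hx0, hq⟩ ρ hρI t ht1 (by
      rw [hρ, sub_sub_cancel, mul_one_div, le_div_iff₀ (by positivity), mul_comm]
      exact le_max_right _ _)
    have h4 : tail ν x ^ 2 ≤ A ^ 2 * t ^ (2 * β) * tail ν ρ ^ 2 :=
      calc tail ν x ^ 2 ≤ (A * t ^ β * tail ν ρ) ^ 2 := by gcongr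
        _ = _ := by ring
    refine (hcoef m).trans ?_
    rw [← hρ, div_mul_eq_mul_div, div_le_div_iff₀ (by positivity) (by positivity)]
    calc B * tail ν x ^ 2 ≤ B * (A ^ 2 * t ^ (2 * β) * tail ν ρ ^ 2) := by gcongr
      _ = _ := by ring
  have hbsq : ∀ m, ‖((derivCoeff ω m : ℂ)
      - if m = 0 then 0 else (derivCoeff ω (m - 1) : ℂ)) * q ^ m‖ ^ 2
      ≤ B ^ 2 * A ^ 4 / tail ν x ^ 4 * ((1 + ((m + 2) * (1 - x)) ^ (4 * β)) * x ^ m) := by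
    intro m
    have h1 : ((derivCoeff ω m : ℂ) - if m = 0 then 0 else (derivCoeff ω (m - 1) : ℂ))
        = (b m : ℂ) := by
      simp only [b]
      split_ifs <;> simp
    have hm0 : (0 : ℝ) ≤ (m + 2) * (1 - x) := by positivity
    rw [h1, norm_mul, Complex.norm_real, Real.norm_eq_abs, norm_pow, ← hx, mul_pow, ← pow_mul]
    have h2 : (max 1 ((m + 2) * (1 - x))) ^ (4 * β) ≤ 1 + ((m + 2) * (1 - x)) ^ (4 * β) := by
      rcases max_choice 1 ((m + 2) * (1 - x)) with h5 | h5 <;> rw [h5]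
      · rw [one_pow]
        have := pow_nonneg hm0 (4 * β)
        linarith
      · linarith
    have h3 : x ^ (m * 2) ≤ x ^ m := pow_le_pow_of_le_one hx0 hq.le (by lia)
    calc |b m| ^ 2 * x ^ (m * 2)
        ≤ (B * A ^ 2 / tail ν x ^ 2 * (max 1 ((m + 2) * (1 - x))) ^ (2 * β)) ^ 2 * x ^ m := by
          gcongr
          exact hbm m
      _ = B ^ 2 * A ^ 4 / tail ν x ^ 4 * ((max 1 ((m + 2) * (1 - x))) ^ (4 * β) * x ^ m) := by
          rw [mul_pow, div_pow, ← pow_mul, ← pow_mul]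
          ring
      _ ≤ _ := by gcongr
  have hsq := Summable.of_nonneg_of_le (fun m => sq_nonneg _) hbsq (hs1.mul_left _)
  -- The choice `lam = ν̂ x ^ 2` balances the two terms of Young's inequality.
  have hmain := integral_norm_unimod_series_le (a := fun m => (derivCoeff ω m : ℂ)) hq
    (summable_derivCoeff hw hq) (lam := tail ν x ^ 2) (by positivity) hsq.hasSum
  have hS : ∑' m, ‖((derivCoeff ω m : ℂ)
      - if m = 0 then 0 else (derivCoeff ω (m - 1) : ℂ)) * q ^ m‖ ^ 2
      ≤ B ^ 2 * A ^ 4 / tail ν x ^ 4 * (D / (1 - x)) := by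
    refine (hsq.tsum_le_tsum hbsq (hs1.mul_left _)).trans ?_
    rw [tsum_mul_left]
    gcongr
  have hP : (1 - x ^ 2)⁻¹ ≤ (1 - x)⁻¹ := by
    have : x ^ 2 ≤ x := by nlinarith
    gcongr
  refine hmain.trans ?_
  calc _ ≤ Real.pi * (tail ν x ^ 2 * (B ^ 2 * A ^ 4 / tail ν x ^ 4 * (D / (1 - x)))
        + (tail ν x ^ 2)⁻¹ * (1 - x)⁻¹) := by
        have := Real.pi_pos
        gcongr
    _ = _ := by field_simp

/-! ### Boundedness into the Bloch type space -/

theorem polarCoord_symm_eq (r θ : ℝ) : Complex.polarCoord.symm (r, θ) = r * unimod θ := by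
  simp [unimod, Complex.exp_mul_I]

/-- The factors `1 / π` and the Jacobian `s` are both at most 1 and are dropped. The inequality form
of Tonelli needs no measurability of `g`. -/
theorem lintegral_areaMeasure_le (g : ℂ → ℝ≥0∞) :
    ∫⁻ ζ, g ζ ∂areaMeasure
      ≤ ∫⁻ s in Ioo (0 : ℝ) 1, ∫⁻ θ in Ioo (-Real.pi) Real.pi, g (s * unimod θ) := by
  have hms : MeasurableSet disc := Metric.isOpen_ball.measurableSet
  have hpi : ENNReal.ofReal (Real.pi)⁻¹ ≤ 1 := by
    rw [ENNReal.ofReal_le_one]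
    exact inv_le_one_of_one_le₀ (by linarith [Real.two_le_pi])
  rw [areaMeasure, lintegral_smul_measure, ← lintegral_indicator hms,
    ← Complex.lintegral_comp_polarCoord_symm, polarCoord_target, Measure.volume_eq_prod,
    ← Measure.prod_restrict]
  refine (mul_le_of_le_one_left (zero_le) hpi).trans ((lintegral_prod_le _).trans ?_)
  rw [← lintegral_indicator measurableSet_Ioo]
  refine (lintegral_mono_ae ?_).trans (setLIntegral_le_lintegral (Ioi 0) _)
  refine (ae_restrict_mem measurableSet_Ioi).mono fun s hs => ?_
  have hs0 : 0 < s := hs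
  by_cases hs1 : s < 1
  · rw [indicator_of_mem (show s ∈ Ioo (0 : ℝ) 1 from ⟨hs0, hs1⟩)]
    refine lintegral_mono fun θ => ?_
    rw [polarCoord_symm_eq]
    refine (mul_le_of_le_one_left (zero_le) (ENNReal.ofReal_le_one.2 hs1.le)).trans ?_
    exact indicator_le_self _ _ _
  · refine le_of_eq_of_le ?_ (zero_le)
    rw [lintegral_eq_zero_of_ae_eq_zero]
    refine Eventually.of_forall fun θ => ?_
    simp only [polarCoord_symm_eq, Pi.zero_apply]
    rw [indicator_of_notMem, smul_zero]
    simpa [disc, norm_unimod, abs_of_pos hs0] using hs1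

theorem ae_norm_mul_le {v : ℝ → ℝ} {f : ℂ → ℂ} (hf : MemGrowth v f) :
    ∀ᵐ ζ ∂areaMeasure, ‖f ζ‖ * v ‖ζ‖ ≤ (growthNorm v f).toReal := by
  filter_upwards [ENNReal.ae_le_essSup
    (fun z => ENNReal.ofReal (‖f z‖ * v ‖z‖))] with ζ hζ
  exact (ENNReal.ofReal_le_iff_le_toReal hf.2.ne).1 hζ

theorem MemGrowth.ae_norm_mul_weight_le {ν : ℝ → ℝ} (h : IsRadialWeight ν) {f : ℂ → ℂ}
    (hf : MemGrowth (tail ν) f) :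
    ∀ᵐ ζ ∂areaMeasure, ‖f ζ * ((ν ‖ζ‖ * tail ν ‖ζ‖ : ℝ) : ℂ)‖
      ≤ (growthNorm (tail ν) f).toReal * ν ‖ζ‖ := by
  filter_upwards [ae_norm_mul_le hf, ae_mem_disc] with ζ h1 hζ
  have hI : ‖ζ‖ ∈ Ico (0 : ℝ) 1 := ⟨norm_nonneg ζ, norm_lt_one hζ⟩
  have h2 := h.nonneg _ hI
  have h3 := h.tail_pos _ hI
  rw [norm_mul, Complex.norm_real, Real.norm_of_nonneg (by positivity)]
  calc ‖f ζ‖ * (ν ‖ζ‖ * tail ν ‖ζ‖) = ‖f ζ‖ * tail ν ‖ζ‖ * ν ‖ζ‖ := by ring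
    _ ≤ _ := by gcongr

theorem MemGrowth.integrable_mul_weight {ν : ℝ → ℝ} (h : IsRadialWeight ν) {f : ℂ → ℂ}
    (hf : MemGrowth (tail ν) f) :
    Integrable (fun ζ => f ζ * ((ν ‖ζ‖ * tail ν ‖ζ‖ : ℝ) : ℂ)) areaMeasure := by
  refine ((integrable_weight h).const_mul (growthNorm (tail ν) f).toReal).mono'
    (hf.1.mul ?_) (hf.ae_norm_mul_weight_le h)
  exact (integrable_weight (isRadialWeight_mul_tail h)).ofReal.aestronglyMeasurable

/-- The weight is chosen so that `|f| ν ν̂` is dominated by a multiple of `ν`; the kernel is then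
integrated circle by circle, and the radial integral loses only a factor `5 / ν̂ r`. -/
theorem UpperDoubling.exists_norm_deriv_bergmanProjection_le {ν : ℝ → ℝ} (h : UpperDoubling ν) :
    ∃ C : ℝ, 0 < C ∧ ∀ f : ℂ → ℂ, MemGrowth (tail ν) f → ∀ z ∈ disc,
      (1 - ‖z‖) * tail ν ‖z‖ * ‖deriv (bergmanProjection (fun r => ν r * tail ν r) f) z‖
        ≤ C * (growthNorm (tail ν) f).toReal := by
  obtain ⟨C, hC, hker⟩ := h.exists_integral_norm_derivKernel_le
  have hw := isRadialWeight_mul_tail h.1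
  refine ⟨C * 5, by positivity, fun f hf z hz => ?_⟩
  have hint := hf.integrable_mul_weight h.1
  rw [(differentiableOn_bergmanProjection_and_deriv hw hint).2 z hz]
  set N := (growthNorm (tail ν) f).toReal with hN
  have hN0 : 0 ≤ N := ENNReal.toReal_nonneg
  set ω : ℝ → ℝ := fun r => ν r * tail ν r with hω
  set r := ‖z‖ with hr
  have hrI : r ∈ Ico (0 : ℝ) 1 := ⟨norm_nonneg z, norm_lt_one hz⟩
  have hr' : 0 < 1 - r := by linarith [hrI.2]
  have hv := h.1.tail_pos r hrI
  set K : ℂ → ℂ := fun ζ =>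
    ∑' m : ℕ, ((m + 1) * z ^ m / (2 * (moment ω (2 * (m + 1) + 1) : ℂ))) * conj ζ ^ m with hK
  have hcircle : ∀ s ∈ Ioo (0 : ℝ) 1, ∫⁻ θ in Ioo (-Real.pi) Real.pi,
      ENNReal.ofReal (‖K (s * unimod θ)‖) ≤ ENNReal.ofReal
        (C / (tail ν (min s r) ^ 2 * (1 - r))) := by
    intro s hs
    -- Up to conjugation, the kernel on the circle of radius `s` is the series with ratio `q`. Since
    -- `|q| = r s ≤ min s r`, its bound may be evaluated at `min s r`.
    set q : ℂ := conj z * s with hq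
    have hqn : ‖q‖ = r * s := by
      rw [hq, norm_mul, RCLike.norm_conj, Complex.norm_real, Real.norm_of_nonneg hs.1.le]
    have hqr : r * s ≤ r := mul_le_of_le_one_right hrI.1 hs.2.le
    have hqs : r * s ≤ s := mul_le_of_le_one_left hs.1.le hrI.2.le
    have hq1 : ‖q‖ < 1 := by rw [hqn]; linarith [hrI.2]
    have hKq : ∀ θ, ‖K (s * unimod θ)‖ = ‖∑' m : ℕ, (derivCoeff ω m : ℂ) * q ^ m * unimod θ ^ m‖ :=
      fun θ => by
        rw [← RCLike.norm_conj, hK, Complex.conj_tsum]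
        congr 1
        refine tsum_congr fun m => ?_
        simp only [derivCoeff, hq, map_mul, map_div₀, map_pow, map_add, map_one, map_natCast,
          map_ofNat, Complex.conj_ofReal, Complex.conj_conj]
        push_cast
        ring
    simp only [hKq]
    have hcont := continuous_unimod_series (summable_derivCoeff hw hq1)
    rw [← ofReal_integral_eq_lintegral_ofReal (integrableOn_of_continuous hcont.norm)
      (Eventually.of_forall fun _ => norm_nonneg _)]
    refine ENNReal.ofReal_le_ofReal ((hker q hq1).trans ?_)
    have hmin0 : 0 ≤ min s r := le_min hs.1.le hrI.1
    have hmin : 0 < tail ν (min s r) :=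
      h.1.tail_pos _ ⟨hmin0, (min_le_right _ _).trans_lt hrI.2⟩
    have hle : tail ν (min s r) ≤ tail ν ‖q‖ := by
      rw [hqn]
      exact tail_le_tail h.1 (mul_nonneg hrI.1 hs.1.le) (le_min hqs hqr)
        ((min_le_left _ _).trans hs.2.le)
    have hle' : 1 - r ≤ 1 - ‖q‖ := by rw [hqn]; linarith
    gcongr
  have hmain : ‖∫ ζ, K ζ * (conj ζ * (f ζ * (ω ‖ζ‖ : ℂ))) ∂areaMeasure‖ₑ
      ≤ ENNReal.ofReal (N * (C / (1 - r)) * (5 / tail ν r)) :=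
    calc _ ≤ ∫⁻ ζ, ‖K ζ * (conj ζ * (f ζ * (ω ‖ζ‖ : ℂ)))‖ₑ ∂areaMeasure :=
          enorm_integral_le_lintegral_enorm _
      _ ≤ ∫⁻ ζ, ENNReal.ofReal (N * ν ‖ζ‖) * ENNReal.ofReal ‖K ζ‖ ∂areaMeasure := by
          refine lintegral_mono_ae ?_
          filter_upwards [hf.ae_norm_mul_weight_le h.1, ae_mem_disc] with ζ h1 hζ
          rw [mul_comm (ENNReal.ofReal _), ← ofReal_norm, norm_mul,
            ENNReal.ofReal_mul (norm_nonneg _)]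
          gcongr
          rw [norm_mul, RCLike.norm_conj]
          exact (mul_le_of_le_one_left (norm_nonneg _) (norm_lt_one hζ).le).trans h1
      _ ≤ ∫⁻ s in Ioo (0 : ℝ) 1, ∫⁻ θ in Ioo (-Real.pi) Real.pi,
            ENNReal.ofReal (N * ν ‖s * unimod θ‖) * ENNReal.ofReal ‖K (s * unimod θ)‖ :=
          lintegral_areaMeasure_le _
      _ ≤ ∫⁻ s in Ioo (0 : ℝ) 1, ENNReal.ofReal
            (N * (C / (1 - r)) * (ν s / tail ν (min s r) ^ 2)) := by
          refine setLIntegral_mono' measurableSet_Ioo fun s hs => ?_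
          have hn : ∀ θ, ‖(s : ℂ) * unimod θ‖ = s := fun θ => by
            rw [norm_mul, norm_unimod, mul_one, Complex.norm_real, Real.norm_of_nonneg hs.1.le]
          have hνs := h.1.nonneg s ⟨hs.1.le, hs.2⟩
          simp only [hn]
          rw [lintegral_const_mul' _ _ ENNReal.ofReal_ne_top]
          refine (mul_le_mul_right (hcircle s hs) _).trans ?_
          rw [← ENNReal.ofReal_mul (by positivity)]
          refine ENNReal.ofReal_le_ofReal (le_of_eq ?_)
          field_simp
      _ = ENNReal.ofReal (N * (C / (1 - r)) *
            ∫ s in Ioo (0 : ℝ) 1, ν s / tail ν (min s r) ^ 2) := by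
          have hi : IntegrableOn (fun s => ν s / tail ν (min s r) ^ 2) (Ioo 0 1) :=
            (intervalIntegrable_div_tail_min_sq h.1 hrI).1.mono_set Ioo_subset_Ioc_self
          rw [← integral_const_mul]
          refine (ofReal_integral_eq_lintegral_ofReal (hi.const_mul _) ?_).symm
          refine (ae_restrict_mem measurableSet_Ioo).mono fun s hs => ?_
          have := h.1.nonneg s ⟨hs.1.le, hs.2⟩
          simp only [Pi.zero_apply]
          positivity
      _ ≤ _ := by
          gcongr
          exact integral_div_tail_min_sq_le h.1 hrI
  rw [← ofReal_norm, ENNReal.ofReal_le_ofReal_iff (by positivity)] at hmain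
  calc _ ≤ (1 - r) * tail ν r * (N * (C / (1 - r)) * (5 / tail ν r)) := by gcongr
    _ = _ := by field_simp

theorem UpperDoubling.boundedToBloch {ν : ℝ → ℝ} (h : UpperDoubling ν) :
    BoundedToBloch (fun r => ν r * tail ν r) (tail ν) := by
  obtain ⟨C, hC, hb⟩ := h.exists_norm_deriv_bergmanProjection_le
  have hw := isRadialWeight_mul_tail h.1
  refine ⟨C.toNNReal, fun f hf => ?_⟩
  have hint := hf.integrable_mul_weight h.1
  have hle : blochNorm (tail ν) (bergmanProjection (fun r => ν r * tail ν r) f)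
      ≤ (C.toNNReal : ℝ≥0∞) * growthNorm (tail ν) f := by
    refine iSup₂_le fun z hz => ?_
    refine (ENNReal.ofReal_le_ofReal (hb f hf z hz)).trans_eq ?_
    rw [ENNReal.ofReal_mul hC.le, ENNReal.ofReal_toReal hf.2.ne]
    rfl
  exact ⟨fun z hz => integrable_bergmanIntegrand hw hint hz,
    ⟨(differentiableOn_bergmanProjection_and_deriv hw hint).1,
      hle.trans_lt (ENNReal.mul_lt_top ENNReal.coe_lt_top hf.2)⟩, hle⟩

/-! ### Unboundedness into the growth space -/

theorem log_div_le_sum_Ico {N M : ℕ} (hN : 1 ≤ N) (hNM : N ≤ M) :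
    Real.log (M / N) ≤ ∑ n ∈ Finset.Ico N M, 1 / (n : ℝ) := by
  have hN' : (0 : ℝ) < N := by exact_mod_cast hN
  induction M, hNM using Nat.le_induction with
  | base => simp [hN'.ne']
  | succ M hNM ih =>
    have hM : (0 : ℝ) < M := by exact_mod_cast hN.trans hNM
    rw [Finset.sum_Ico_succ_top hNM]
    have h1 : ((M + 1 : ℕ) : ℝ) / N = M / N * ((M + 1) / M) := by
      push_cast
      field_simp
    rw [h1, Real.log_mul (by positivity) (by positivity)]
    have h2 := Real.log_le_sub_one_of_pos (show 0 < ((M : ℝ) + 1) / M by positivity)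
    have h3 : ((M : ℝ) + 1) / M - 1 = 1 / M := by
      field_simp
      ring
    linarith

theorem integral_mul_conj_unimod_pow (n : ℕ) :
    ∫ θ in Ioo (-Real.pi) Real.pi, (θ : ℂ) * conj (unimod θ) ^ n
      = 2 * Real.pi * Complex.I * (-1) ^ n / n := by
  have hpi := Real.pi_pos
  rw [← integral_Ioc_eq_integral_Ioo, ← intervalIntegral.integral_of_le (by linarith)]
  -- For `n = 0` the integrand is odd, which agrees with the value 0 of division by zero.
  rcases Nat.eq_zero_or_pos n with rfl | hn
  · simp only [pow_zero, mul_one, Nat.cast_zero, div_zero]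
    rw [intervalIntegral.integral_ofReal, integral_id]
    simp
  have hn' : (n : ℂ) ≠ 0 := by exact_mod_cast hn.ne'
  -- The antiderivative found by integration by parts.
  have hd : ∀ θ ∈ uIcc (-Real.pi) Real.pi, HasDerivAt
      (fun θ : ℝ => (Complex.I * θ / n + 1 / (n : ℂ) ^ 2) *
        Complex.exp (-(n * Complex.I) * θ)) ((θ : ℂ) * conj (unimod θ) ^ n) θ := by
    intro θ _
    have he : conj (unimod θ) ^ n = Complex.exp (-(n * Complex.I) * θ) := by
      simp only [unimod, ← Complex.exp_conj, ← Complex.exp_nat_mul, map_mul, Complex.conj_ofReal,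
        Complex.conj_I]
      congr 1
      ring
    have h1 : HasDerivAt (fun θ : ℝ => (θ : ℂ)) 1 θ := Complex.ofRealCLM.hasDerivAt
    have h2 := (((h1.const_mul Complex.I).div_const (n : ℂ)).add_const (1 / (n : ℂ) ^ 2)).mul
      (h1.const_mul (-(n * Complex.I))).cexp
    rw [he]
    refine h2.congr_deriv ?_
    field_simp
    ring_nf
    rw [Complex.I_sq]
    ring
  rw [intervalIntegral.integral_eq_sub_of_hasDerivAt hd
    (Continuous.intervalIntegrable (by fun_prop) _ _)]
  have hexp1 : Complex.exp (-(n * Complex.I) * (Real.pi : ℂ)) = (-1) ^ n := by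
    rw [show -(n * Complex.I) * (Real.pi : ℂ) = n * -(Real.pi * Complex.I) by ring,
      Complex.exp_nat_mul, Complex.exp_neg, Complex.exp_pi_mul_I]
    norm_num
  have hexp2 : Complex.exp (-(n * Complex.I) * ((-Real.pi : ℝ) : ℂ)) = (-1) ^ n := by
    push_cast
    rw [show -(n * Complex.I) * -(Real.pi : ℂ) = n * (Real.pi * Complex.I) by ring,
      Complex.exp_nat_mul, Complex.exp_pi_mul_I]
  rw [hexp1, hexp2]
  push_cast
  field_simp
  ring

/-- In polar coordinates the integrand is a product of a function of the radius and one of the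
angle; the Jacobian raises `s ^ n` to `s ^ (n + 1)`. -/
theorem integral_conj_pow_mul_arg (G : ℝ → ℝ) (n : ℕ) :
    ∫ ζ : ℂ, conj ζ ^ n * ((Complex.arg ζ : ℂ) * (G ‖ζ‖ : ℂ)) ∂areaMeasure
      = 2 * Complex.I * (-1) ^ n / n * ((∫ s in Ioo (0 : ℝ) 1, s ^ (n + 1) * G s : ℝ) : ℂ) := by
  have hpi := Real.pi_pos
  have hms : MeasurableSet disc := Metric.isOpen_ball.measurableSet
  rw [areaMeasure, integral_smul_measure, ENNReal.toReal_ofReal (by positivity),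
    ← integral_indicator hms, ← Complex.integral_comp_polarCoord_symm, polarCoord_target,
    Measure.volume_eq_prod, ← Measure.prod_restrict]
  have hcongr : ∀ᵐ p ∂((volume.restrict (Ioi (0 : ℝ))).prod
      (volume.restrict (Ioo (-Real.pi) Real.pi))),
      p.1 • disc.indicator (fun ζ : ℂ => conj ζ ^ n * ((Complex.arg ζ : ℂ) * (G ‖ζ‖ : ℂ)))
        (Complex.polarCoord.symm p)
      = (((Ioo (0 : ℝ) 1).indicator (fun s => s ^ (n + 1) * G s) p.1 : ℝ) : ℂ) *
        ((p.2 : ℂ) * conj (unimod p.2) ^ n) := by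
    rw [Measure.prod_restrict]
    refine (ae_restrict_mem (measurableSet_Ioi.prod measurableSet_Ioo)).mono ?_
    rintro ⟨s, θ⟩ ⟨hs, hθ⟩
    have hs0 : 0 < s := hs
    have hn : ‖(s : ℂ) * unimod θ‖ = s := by
      rw [norm_mul, norm_unimod, mul_one, Complex.norm_real, Real.norm_of_nonneg hs0.le]
    have hmem : (s : ℂ) * unimod θ ∈ disc ↔ s < 1 := by
      rw [disc, mem_ball_zero_iff, hn]
    simp only [polarCoord_symm_eq]
    by_cases hs1 : s < 1
    · rw [indicator_of_mem (show s ∈ Ioo (0 : ℝ) 1 from ⟨hs0, hs1⟩),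
        indicator_of_mem (hmem.2 hs1), hn, Complex.real_smul]
      have harg : Complex.arg ((s : ℂ) * unimod θ) = θ := by
        rw [unimod, Complex.arg_real_mul _ hs0, Complex.arg_exp_mul_I, toIocMod_eq_self]
        exact ⟨hθ.1, by have := hθ.2; simp only at this; linarith⟩
      rw [harg, map_mul, Complex.conj_ofReal]
      push_cast
      ring
    · rw [indicator_of_notMem (show s ∉ Ioo (0 : ℝ) 1 from fun h1 => hs1 h1.2),
        indicator_of_notMem (mt hmem.1 hs1)]
      simp
  rw [integral_congr_ae hcongr,
    integral_prod_mul (fun s : ℝ => (((Ioo (0 : ℝ) 1).indicator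
      (fun s => s ^ (n + 1) * G s) s : ℝ) : ℂ)) (fun θ : ℝ => (θ : ℂ) * conj (unimod θ) ^ n),
    integral_complex_ofReal, integral_mul_conj_unimod_pow, integral_indicator measurableSet_Ioo,
    Measure.restrict_restrict measurableSet_Ioo, inter_eq_left.2 Ioo_subset_Ioi_self,
    Complex.real_smul]
  have : (Real.pi : ℂ) ≠ 0 := by exact_mod_cast hpi.ne'
  push_cast
  field_simp

/-- By continuity a violation would persist on a nonempty open set, which has positive measure, so
the essential bound holds at every point. -/
theorem norm_mul_le_of_growthNorm_le {v : ℝ → ℝ} (hv : ContinuousOn v (Icc (0 : ℝ) 1)) {f : ℂ → ℂ}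
    (hf : ContinuousOn f disc) {M : ℝ} (hM : 0 ≤ M) (h : growthNorm v f ≤ ENNReal.ofReal M)
    {z : ℂ} (hz : z ∈ disc) : ‖f z‖ * v ‖z‖ ≤ M := by
  by_contra! hlt
  have hg : ContinuousOn (fun z => ‖f z‖ * v ‖z‖) disc :=
    hf.norm.mul (hv.comp continuous_norm.continuousOn fun w hw =>
      ⟨norm_nonneg w, (norm_lt_one hw).le⟩)
  have hU := hg.isOpen_inter_preimage Metric.isOpen_ball (isOpen_Ioi (a := M))
  have hpos := hU.measure_pos volume ⟨z, hz, hlt⟩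
  have hae : ∀ᵐ w ∂areaMeasure, ‖f w‖ * v ‖w‖ ≤ M := by
    filter_upwards [ENNReal.ae_le_essSup (fun z => ENNReal.ofReal (‖f z‖ * v ‖z‖))] with w hw
    exact (ENNReal.ofReal_le_ofReal_iff hM).1 (hw.trans h)
  rw [areaMeasure, Measure.ae_ennreal_smul_measure_iff
    (ENNReal.ofReal_pos.2 (inv_pos.2 Real.pi_pos)).ne',
    ae_restrict_iff' (show MeasurableSet disc from Metric.isOpen_ball.measurableSet)] at hae
  refine hpos.ne' (measure_mono_null ?_ hae)
  rintro w ⟨hw1, hw2⟩ hc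
  exact absurd (hc hw1) (not_le.2 hw2)

theorem memGrowth_div_tail {ν : ℝ → ℝ} (h : IsRadialWeight ν) {φ : ℂ → ℝ} (hφ : Measurable φ)
    {M : ℝ} (hM : ∀ ζ, |φ ζ| ≤ M) :
    MemGrowth (tail ν) (fun ζ => (φ ζ : ℂ) * ((tail ν ‖ζ‖)⁻¹ : ℝ)) ∧
      growthNorm (tail ν) (fun ζ => (φ ζ : ℂ) * ((tail ν ‖ζ‖)⁻¹ : ℝ)) ≤ ENNReal.ofReal M := by
  have hI : ∀ ζ ∈ disc, ‖ζ‖ ∈ Ico (0 : ℝ) 1 := fun ζ hζ => ⟨norm_nonneg ζ, norm_lt_one hζ⟩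
  have hle : growthNorm (tail ν) (fun ζ => (φ ζ : ℂ) * ((tail ν ‖ζ‖)⁻¹ : ℝ))
      ≤ ENNReal.ofReal M := by
    refine essSup_le_of_ae_le _ ?_
    filter_upwards [ae_mem_disc] with ζ hζ
    have hv := h.tail_pos _ (hI ζ hζ)
    refine ENNReal.ofReal_le_ofReal ?_
    rw [norm_mul, Complex.norm_real, Complex.norm_real, Real.norm_eq_abs,
      Real.norm_of_nonneg (by positivity), inv_mul_cancel_right₀ hv.ne']
    exact hM ζ
  refine ⟨⟨?_, hle.trans_lt ENNReal.ofReal_lt_top⟩, hle⟩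
  refine (Complex.measurable_ofReal.comp hφ).aestronglyMeasurable.mul ?_
  have hc : ContinuousOn (fun ζ : ℂ => (((tail ν ‖ζ‖)⁻¹ : ℝ) : ℂ)) disc := by
    refine Complex.continuous_ofReal.comp_continuousOn (ContinuousOn.inv₀ ?_ fun ζ hζ =>
      (h.tail_pos _ (hI ζ hζ)).ne')
    exact (tail_continuousOn h).comp continuous_norm.continuousOn fun ζ hζ =>
      Ico_subset_Icc_self (hI ζ hζ)
  exact (hc.aestronglyMeasurable Metric.isOpen_ball.measurableSet).smul_measure _

/-- At the origin the kernel is the nonzero constant `1 / (2 ω_1)`. -/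
theorem integrable_mul_weight_of_bergmanIntegrand {ω : ℝ → ℝ} (h : IsRadialWeight ω) {f : ℂ → ℂ}
    (hf : Integrable (bergmanIntegrand ω f 0) areaMeasure) :
    Integrable (fun ζ => f ζ * (ω ‖ζ‖ : ℂ)) areaMeasure := by
  have hm : (moment ω 1 : ℂ) ≠ 0 := by exact_mod_cast (moment_pos h 1).ne'
  refine (hf.const_mul (2 * (moment ω 1 : ℂ))).congr (Eventually.of_forall fun ζ => ?_)
  simp only [bergmanIntegrand_eq]
  rw [tsum_eq_single 0 fun n hn => by simp [hn]]
  simp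
  field_simp

/-- Split `s ^ (2n+1)` as `s ^ (n+1)` times `s ^ n`; the second factor turns `ν̂ s` into a multiple
of `ν̂ r`. The constant depends on `ν` only, not on `ω`. -/
theorem UpperDoubling.exists_moment_le_mul_integral {ν : ℝ → ℝ} (h : UpperDoubling ν) :
    ∃ C : ℝ, 0 < C ∧ ∀ ω : ℝ → ℝ, IsRadialWeight ω →
      IntegrableOn (fun s => s * (ω s / tail ν s)) (Ioo 0 1) →
      ∀ n : ℕ, ∀ r ∈ Ico (0 : ℝ) 1, 1 ≤ n * (1 - r) →
      moment ω (2 * n + 1) ≤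
        C * tail ν r * ∫ s in Ioo (0 : ℝ) 1, s ^ (n + 1) * (ω s / tail ν s) := by
  obtain ⟨C, hC, hb⟩ := h.exists_pow_mul_tail_pow_le 1
  refine ⟨C, hC, fun ω hω hint n r hr hn => ?_⟩
  have hi : IntegrableOn (fun s => s ^ (n + 1) * (ω s / tail ν s)) (Ioo 0 1) := by
    have h1 := hint.bdd_mul (f := fun s : ℝ => s ^ n) (c := 1) (by fun_prop) (by
      refine (ae_restrict_mem measurableSet_Ioo).mono fun s hs => ?_
      rw [norm_pow, Real.norm_of_nonneg hs.1.le]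
      exact pow_le_one₀ hs.1.le hs.2.le)
    refine h1.congr (Eventually.of_forall fun s => ?_)
    simp only
    ring
  rw [moment_eq, ← integral_const_mul]
  refine setIntegral_mono_on (integrableOn_pow_mul hω _) (hi.const_mul _) measurableSet_Ioo
    fun s hs => ?_
  have hsI : s ∈ Ico (0 : ℝ) 1 := ⟨hs.1.le, hs.2⟩
  have hv := h.1.tail_pos s hsI
  have hωs := hω.nonneg s hsI
  have hs0 := hs.1
  have hkey := hb n s hsI r hr (by linarith)
  rw [pow_one, pow_one] at hkey
  calc s ^ (2 * n + 1) * ω s = s ^ (n + 1) * (ω s / tail ν s) * (s ^ n * tail ν s) := by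
        field_simp
        ring
    _ ≤ s ^ (n + 1) * (ω s / tail ν s) * (C * tail ν r) := by gcongr
    _ = _ := by ring

/-- The signs `(-1) ^ n` of the coefficients of `arg` cancel those of `(-ρ) ^ n`, so after
multiplication by `-i` every term is nonnegative and partial sums are lower bounds. -/
theorem sum_le_norm_bergmanProjection_arg {ν ω : ℝ → ℝ} (hω : IsRadialWeight ω)
    (hν : IsRadialWeight ν)
    (hf : Integrable (fun ζ : ℂ => (Complex.arg ζ : ℂ) * ((tail ν ‖ζ‖)⁻¹ : ℝ) * (ω ‖ζ‖ : ℂ))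
      areaMeasure) {ρ : ℝ} (hρ0 : 0 ≤ ρ) (hρ1 : ρ < 1) (T : Finset ℕ) :
    ∑ n ∈ T, ρ ^ n / n *
        ((∫ s in Ioo (0 : ℝ) 1, s ^ (n + 1) * (ω s / tail ν s)) / moment ω (2 * n + 1))
      ≤ ‖bergmanProjection ω (fun ζ => (Complex.arg ζ : ℂ) * ((tail ν ‖ζ‖)⁻¹ : ℝ)) (-ρ)‖ := by
  set m : ℕ → ℝ := fun n => ∫ s in Ioo (0 : ℝ) 1, s ^ (n + 1) * (ω s / tail ν s) with hm
  set P := bergmanProjection ω (fun ζ => (Complex.arg ζ : ℂ) * ((tail ν ‖ζ‖)⁻¹ : ℝ)) (-ρ)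
  have hz : (-ρ : ℂ) ∈ disc := by simpa [disc, abs_of_nonneg hρ0] using hρ1
  have hsum := hasSum_bergmanProjection hω hf hz
  have hμ : ∀ n : ℕ, ∫ ζ : ℂ, conj ζ ^ n *
      ((Complex.arg ζ : ℂ) * ((tail ν ‖ζ‖)⁻¹ : ℝ) * (ω ‖ζ‖ : ℂ)) ∂areaMeasure
      = 2 * Complex.I * (-1) ^ n / n * (m n : ℂ) := by
    intro n
    rw [hm, ← integral_conj_pow_mul_arg]
    refine integral_congr_ae (Eventually.of_forall fun ζ => ?_)
    push_cast
    ring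
  simp only [hμ] at hsum
  have hterm : ∀ n : ℕ, -Complex.I * ((-ρ : ℂ) ^ n / (2 * (moment ω (2 * n + 1) : ℂ)) *
      (2 * Complex.I * (-1) ^ n / n * (m n : ℂ)))
      = ((ρ ^ n / n * (m n / moment ω (2 * n + 1)) : ℝ) : ℂ) := by
    intro n
    have h1 : ((-1 : ℂ) ^ n) * (-1) ^ n = 1 := by rw [← mul_pow]; simp
    have h2 : (-ρ : ℂ) ^ n = (-1) ^ n * ρ ^ n := by rw [← neg_one_mul, mul_pow]
    rw [h2]
    push_cast
    calc _ = -(Complex.I * Complex.I) * (((-1 : ℂ) ^ n) * (-1) ^ n) *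
          ((ρ : ℂ) ^ n / n * (m n / moment ω (2 * n + 1))) := by
          field_simp
      _ = _ := by rw [h1, Complex.I_mul_I]; ring
  have h3 := hsum.mul_left (-Complex.I)
  simp only [hterm] at h3
  have h4 := Complex.hasSum_re h3
  simp only [Complex.ofReal_re] at h4
  have hnn : ∀ n, 0 ≤ m n := fun n => setIntegral_nonneg measurableSet_Ioo fun s hs => by
    have hsI : s ∈ Ico (0 : ℝ) 1 := ⟨hs.1.le, hs.2⟩
    have h5 := hν.tail_pos s hsI
    have h6 := hω.nonneg s hsI
    have h7 := hs.1
    positivity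
  refine (sum_le_hasSum T (fun n _ => ?_) h4).trans ((Complex.re_le_norm _).trans_eq ?_)
  · have h5 := moment_pos hω (2 * n + 1)
    have h6 := hnn n
    positivity
  · rw [norm_mul]
    simp [P]

theorem UpperDoubling.not_boundedToHardyGrowth {ν : ℝ → ℝ} (h : UpperDoubling ν)
    (h' : ¬ LowerDoubling ν) {ω : ℝ → ℝ} (hω : IsRadialWeight ω) :
    ¬ BoundedToHardyGrowth ω (tail ν) := by
  rintro ⟨C₀, hC₀⟩
  have hpi := Real.pi_pos
  have h0 : (0 : ℂ) ∈ disc := by simp [disc]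
  obtain ⟨hf, hfn⟩ := memGrowth_div_tail h.1 Complex.measurable_arg Complex.abs_arg_le_pi
  -- The function `1 / ν̂` serves only to deduce integrability of `ω / ν̂` from convergence at the
  -- origin.
  obtain ⟨hg, -⟩ := memGrowth_div_tail h.1 (φ := fun _ => 1) measurable_const (M := 1) (by simp)
  have hfi := integrable_mul_weight_of_bergmanIntegrand hω ((hC₀ _ hf).1 0 h0)
  have hgi := integrable_mul_weight_of_bergmanIntegrand hω ((hC₀ _ hg).1 0 h0)
  have hint : IntegrableOn (fun s => s * (ω s / tail ν s)) (Ioo 0 1) := by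
    have h1 : Integrable (fun ζ : ℂ => ω ‖ζ‖ / tail ν ‖ζ‖) areaMeasure := by
      refine hgi.re.congr (Eventually.of_forall fun ζ => ?_)
      simp only [Complex.ofReal_one, one_mul, ← Complex.ofReal_mul]
      rw [RCLike.re_eq_complex_re, Complex.ofReal_re]
      ring
    rw [areaMeasure, integrable_smul_measure (ENNReal.ofReal_pos.2 (inv_pos.2 hpi)).ne'
      ENNReal.ofReal_ne_top] at h1
    have := (integrableOn_fun_norm_addHaar (volume : Measure ℂ)
      (f := fun s => ω s / tail ν s) (r := 1)).1 h1
    simpa [Complex.finrank_real_complex] using this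
  obtain ⟨C, hC, hmom⟩ := h.exists_moment_le_mul_integral
  have hup : ∀ z ∈ disc, ‖bergmanProjection ω
      (fun ζ => (Complex.arg ζ : ℂ) * ((tail ν ‖ζ‖)⁻¹ : ℝ)) z‖ * tail ν ‖z‖ ≤ C₀ * Real.pi := by
    intro z hz
    refine norm_mul_le_of_growthNorm_le (tail_continuousOn h.1)
      (hC₀ _ hf).2.1.1.continuousOn (by positivity) ((hC₀ _ hf).2.2.trans ?_) hz
    rw [ENNReal.ofReal_mul C₀.coe_nonneg, ENNReal.ofReal_coe_nnreal]
    gcongr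
  -- Chosen so that `log (K / 4)` exceeds what the assumed bound `C₀ π` allows after the losses `C`,
  -- `e ^ 2` and 2.
  set K : ℝ := 4 * Real.exp (2 * C * Real.exp 2 * (C₀ * Real.pi + 1)) with hK
  have hK4 : 4 ≤ K := by
    have : 1 ≤ Real.exp (2 * C * Real.exp 2 * (C₀ * Real.pi + 1)) :=
      Real.one_le_exp (by positivity)
    linarith
  have hfreq : ∃ᶠ r in 𝓝[<] (1 : ℝ), tail ν r < 2 * tail ν (1 - (1 - r) / K) := by
    intro hev
    refine h' ⟨h.1, K, by linarith, 2, one_lt_two, ?_⟩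
    simpa only [not_lt] using hev
  obtain ⟨r, hr, hr2, hr1⟩ := (hfreq.and_eventually
    (Ioo_mem_nhdsLT (show (1 / 2 : ℝ) < 1 by norm_num))).exists
  set δ := 1 - r with hδ
  have hδ0 : 0 < δ := by linarith
  have hδ2 : δ ≤ 1 / 2 := by linarith
  set ρ := 1 - δ / K with hρ
  have hK0 : 0 < K := by linarith
  have hδK : δ / K ≤ 1 / 2 := by rw [div_le_iff₀ hK0]; nlinarith
  have hδK0 : 0 < δ / K := by positivity
  have hρ0 : 1 / 2 ≤ ρ := by linarith
  have hρ1 : ρ < 1 := by linarith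
  have hrI : r ∈ Ico (0 : ℝ) 1 := ⟨by linarith, hr1⟩
  have hvr := h.1.tail_pos r hrI
  have hvρ := h.1.tail_pos ρ ⟨by linarith, hρ1⟩
  -- From `1 / δ` on, the moment comparison at `r` holds; up to `K / δ`, the factor `ρ ^ n` stays
  -- above `e^{-2}`. Rounding costs a factor 4 in `M / N`, hence `K / 4` in the logarithm.
  set N := ⌈1 / δ⌉₊ with hN
  set M := ⌊K / δ⌋₊ with hM
  have hδinv : 2 ≤ 1 / δ := by rw [le_div_iff₀ hδ0]; linarith
  have hN1 : 1 / δ ≤ N := Nat.le_ceil _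
  have hN2 : (N : ℝ) ≤ 2 * (1 / δ) := by
    have := Nat.ceil_lt_add_one (show 0 ≤ 1 / δ by positivity)
    linarith
  have hKδ : K / δ = K * (1 / δ) := by ring
  have hM1 : (M : ℝ) ≤ K / δ := Nat.floor_le (by positivity)
  have hM2 : K / 2 * (1 / δ) ≤ M := by
    have := Nat.lt_floor_add_one (K / δ)
    nlinarith
  have hNM : N ≤ M := by
    have : (N : ℝ) ≤ M := by nlinarith
    exact_mod_cast this
  have hN0 : 1 ≤ N := by
    have : (1 : ℝ) ≤ N := by linarith
    exact_mod_cast this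
  have hlog : Real.log (K / 4) ≤ ∑ n ∈ Finset.Ico N M, 1 / (n : ℝ) := by
    refine le_trans (Real.log_le_log (by positivity) ?_) (log_div_le_sum_Ico hN0 hNM)
    rw [le_div_iff₀ (by exact_mod_cast hN0)]
    nlinarith
  have hsum := sum_le_norm_bergmanProjection_arg hω h.1 hfi (by linarith) hρ1 (Finset.Ico N M)
  have hlow : Real.exp (-(2 * 1)) / (C * tail ν r) * ∑ n ∈ Finset.Ico N M, 1 / (n : ℝ)
      ≤ ∑ n ∈ Finset.Ico N M, ρ ^ n / n *
        ((∫ s in Ioo (0 : ℝ) 1, s ^ (n + 1) * (ω s / tail ν s)) / moment ω (2 * n + 1)) := by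
    rw [Finset.mul_sum]
    refine Finset.sum_le_sum fun n hn => ?_
    obtain ⟨hnN, hnM⟩ := Finset.mem_Ico.1 hn
    have hnN' : (N : ℝ) ≤ n := by exact_mod_cast hnN
    have hnM' : (n : ℝ) ≤ M := by exact_mod_cast hnM.le
    have hn0 : (0 : ℝ) < n := by linarith
    have h1 : Real.exp (-(2 * 1)) ≤ ρ ^ n := by
      refine exp_neg_le_pow hρ0 hρ1.le ?_
      rw [hρ, sub_sub_cancel]
      calc (n : ℝ) * (δ / K) ≤ K / δ * (δ / K) := by gcongr; linarith
        _ = 1 := by field_simp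
    have h2 := hmom ω hω hint n r hrI (by
      rw [← hδ]
      calc 1 = 1 / δ * δ := by field_simp
        _ ≤ n * δ := by gcongr; linarith)
    have hp := moment_pos hω (2 * n + 1)
    have h3 : 1 / (C * tail ν r) ≤
        (∫ s in Ioo (0 : ℝ) 1, s ^ (n + 1) * (ω s / tail ν s)) / moment ω (2 * n + 1) := by
      rw [div_le_div_iff₀ (by positivity) hp]
      linarith
    calc Real.exp (-(2 * 1)) / (C * tail ν r) * (1 / (n : ℝ))
        = Real.exp (-(2 * 1)) / n * (1 / (C * tail ν r)) := by ring
      _ ≤ _ := by gcongr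
  have hz : (-ρ : ℂ) ∈ disc := by
    simpa [disc, abs_of_nonneg (show 0 ≤ ρ by linarith)] using hρ1
  have hfin := hup _ hz
  have hnρ : ‖(-ρ : ℂ)‖ = ρ := by
    rw [norm_neg, Complex.norm_real, Real.norm_of_nonneg (by linarith)]
  rw [hnρ] at hfin
  have hlogK : Real.log (K / 4) = 2 * C * Real.exp 2 * (C₀ * Real.pi + 1) := by
    rw [hK, mul_div_cancel_left₀ _ (by norm_num), Real.log_exp]
  have hchain : Real.exp (-(2 * 1)) / (C * tail ν r) * Real.log (K / 4) * tail ν ρ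
      ≤ C₀ * Real.pi := by
    refine le_trans ?_ hfin
    gcongr
    refine le_trans ?_ (hlow.trans hsum)
    gcongr
  have hval : Real.exp (-(2 * 1)) / (C * tail ν r) * Real.log (K / 4) * tail ν ρ
      = (2 * tail ν ρ / tail ν r) * (C₀ * Real.pi + 1) := by
    rw [hlogK, mul_one, Real.exp_neg]
    field_simp
  -- The failure of lower doubling at `r`; it turns `hchain` into `C₀ π + 1 ≤ C₀ π`.
  have hratio : 1 ≤ 2 * tail ν ρ / tail ν r := by
    rw [one_le_div hvr]
    exact hr.le
  have hnn : 0 ≤ C₀ * Real.pi + 1 := by positivity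
  rw [hval] at hchain
  nlinarith

end RadialBergman

theorem mainTheorem10 (ν : ℝ → ℝ) (hν : RadialBergman.UpperDoubling ν)
    (hν' : ¬ RadialBergman.LowerDoubling ν) :
    (∀ ω : ℝ → ℝ, RadialBergman.IsRadialWeight ω →
      ¬ RadialBergman.BoundedToHardyGrowth ω (RadialBergman.tail ν)) ∧
    RadialBergman.IsRadialWeight (fun r => ν r * RadialBergman.tail ν r) ∧
    RadialBergman.BoundedToBloch (fun r => ν r * RadialBergman.tail ν r)
      (RadialBergman.tail ν) :=
  ⟨fun _ hω => hν.not_boundedToHardyGrowth hν' hω,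
    RadialBergman.isRadialWeight_mul_tail hν.1, hν.boundedToBloch⟩
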